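/- Let $d\ge 3$, $n\ge 2$, $j\in\{1,\dots,n-1\}$, $h,i\in\{0,1\}$, $c>0$ and $t>0$. A particle starts at the origin of $\mathbb R^d$ and moves with constant speed $c$; it changes direction at random instants $0=t_0<t_1<t_2<\cdots$, and its successive directions $V_1,V_2,\dots$ are independent, uniformly distributed on the unit sphere of $\mathbb R^d$, and independent of the instants. Put $\tau_k=t_k-t_{k-1}$ and let $\mathcal N(t)=\sup\{k\ge 1: t_k\le t\}$ (with $\sup\emptyset=0$) be the number of changes of direction in $[0,t]$. On $\{\mathcal N(t)=m\}$ the position at time $t$ is $$X_d^{h,i,j}(t)=c\Big(\sum_{k=1}^{m}\tau_kV_k+\big(t-\sum_{k=1}^m\tau_k\big)V_{m+1}\Big).$$ Assume that for every $m\ge 1$ with $P(\mathcal N(t)=m)>0$, conditionally on $\mathcal N(t)=m$, the vector $(\tau_1,\dots,\tau_m)$ has the (rescaled) generalized Dirichlet density $$\frac{1}{t^{\sum_{k=1}^m(a_k+b_k-1)}}\prod_{k=1}^m\frac{\Gamma\big(1+\sum_{l=k}^m(a_l+b_l-1)\big)}{\Gamma(a_k)\,\Gamma\big(b_k+\sum_{l=k+1}^m(a_l+b_l-1)\big)}\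 \prod_{k=1}^m\tau_k^{a_k-1}\Big(t-\sum_{l=1}^k\tau_l\Big)^{b_k-1}$$ on the simplex $\{0<\tau_k<t-\sum_{l<k}\tau_l,\ k=1,\dots,m\}$, with the following "switching phase" parameters. If $m\le j$: $a_k=d-1$ for all $k$, $b_k=1$ for $k<m$, and $b_m=d-1$. If $m>j$: $a_k=d-1$ for $k\le j$ and $a_k=\frac d2-1$ for $j<k\le m$; $b_j=(m-j+1)(\frac d2-1)+i+h+1$, $b_m=\frac d2-i$, and $b_k=1$ for all other $k$. If $P(\mathcal N(t)=n)>0$, then, conditionally on $\mathcal N(t)=n$, the random vector $X_d^{h,i,j}(t)$ is absolutely continuous with respect to Lebesgue measure on $\mathbb R^d$, with density $$p_n^j(x,t)=\frac{\Gamma\big((n+1)(\frac d2-1)+\frac j2+1\big)}{\Gamma\big(n(\frac d2-1)+\frac j2\big)}\;\frac{(c^2t^2-\|x\|^2)^{\,n(\frac d2-1)+\frac j2-1}}{\pi^{d/2}\,(ct)^{2(n+1)(\frac d2-1)+j}},\qquad \|x\|<ct,$$ and $p_n^j(x,t)=0$ for $\|x\|\ge ct$. -/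

import Mathlib

open MeasureTheory ProbabilityTheory

noncomputable section

namespace DirichletWalk

/-! ### The rescaled generalized Dirichlet distribution

Vectors of length `n` are indexed by `Fin n`; the index `k : Fin n` stands for the `(k + 1)`-st
coordinate. -/

/-- The open simplex of all `τ` with `0 < τ_k < t - ∑_{l < k} τ_l` for every `k`. -/
def simplex (n : ℕ) (t : ℝ) : Set (Fin n → ℝ) :=
  {τ | ∀ k, 0 < τ k ∧ τ k < t - ∑ l ∈ Finset.Iio k, τ l}

/-- The normalizing constant of the rescaled generalized Dirichlet density. -/
def gdConst {n : ℕ} (a b : Fin n → ℝ) (t : ℝ) : ℝ :=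
  1 / t ^ (∑ k, (a k + b k - 1)) *
    ∏ k, Real.Gamma (1 + ∑ l ∈ Finset.Ici k, (a l + b l - 1)) /
      (Real.Gamma (a k) * Real.Gamma (b k + ∑ l ∈ Finset.Ioi k, (a l + b l - 1)))

/-- The rescaled generalized Dirichlet density (extended by zero off the simplex). -/
def gdDensity {n : ℕ} (a b : Fin n → ℝ) (t : ℝ) : (Fin n → ℝ) → ℝ :=
  (simplex n t).indicator fun τ =>
    gdConst a b t *
      ∏ k, (τ k ^ (a k - 1) * (t - ∑ l ∈ Finset.Iic k, τ l) ^ (b k - 1))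

/-- The rescaled generalized Dirichlet distribution `GD(a; b)` on the simplex of size `t`. -/
def generalizedDirichlet {n : ℕ} (a b : Fin n → ℝ) (t : ℝ) : Measure (Fin n → ℝ) :=
  volume.withDensity fun τ => ENNReal.ofReal (gdDensity a b t τ)

/-! ### The parameters of the walk with switching phase -/

/-- The parameters `a_1, …, a_n`. -/
def switchA (d j n : ℕ) (k : Fin n) : ℝ :=
  if n ≤ j then (d : ℝ) - 1
  else if (k : ℕ) + 1 ≤ j then (d : ℝ) - 1
  else (d : ℝ) / 2 - 1

/-- The parameters `b_1, …, b_n`. -/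
def switchB (d h i j n : ℕ) (k : Fin n) : ℝ :=
  if n ≤ j then
    if (k : ℕ) + 1 = n then (d : ℝ) - 1 else 1
  else if (k : ℕ) + 1 = j then
    ((n : ℝ) - j + 1) * ((d : ℝ) / 2 - 1) + i + h + 1
  else if (k : ℕ) + 1 = n then (d : ℝ) / 2 - i
  else 1

/-! ### Random walks with uniformly distributed directions -/

/-- The unit sphere of `ℝ^d`. -/
abbrev UnitSphere (d : ℕ) : Type := Metric.sphere (0 : EuclideanSpace ℝ (Fin d)) 1

/-- The uniform distribution on the unit sphere: the normalized surface measure. -/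
def uniformSphere (d : ℕ) : Measure (UnitSphere d) :=
  ((volume : Measure (EuclideanSpace ℝ (Fin d))).toSphere Set.univ)⁻¹ •
    (volume : Measure (EuclideanSpace ℝ (Fin d))).toSphere

variable {Ω : Type*}

/-- The number of changes of direction in `[0, t]`: the supremum of all `k ≥ 1` with `T_k ≤ t`
(zero if there are none), where `T_k` is the instant of the `k`-th change. -/
def numChanges (T : ℕ → Ω → ℝ) (t : ℝ) (ω : Ω) : ℕ∞ :=
  ⨆ (k : ℕ) (_ : 1 ≤ k ∧ T k ω ≤ t), (k : ℕ∞)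

/-- The position at time `t` of the particle that starts at the origin and moves with speed `c`
in direction `V_k` between the instants `T_k` and `T_{k + 1}` (`k = 0, 1, 2, …`, `T_0 = 0`). If
there are `n` changes of direction in `[0, t]`, then it has made `n` full steps of durations
`T_{k + 1} - T_k`, `k < n`, and a last one of duration `t - T_n`. (The value is irrelevant
where the number of changes is infinite.) -/
def position {d : ℕ} (c : ℝ) (T : ℕ → Ω → ℝ) (V : ℕ → Ω → UnitSphere d) (t : ℝ) (ω : Ω) :
    EuclideanSpace ℝ (Fin d) :=
  let n := (numChanges T t ω).toNat
  c • (∑ k ∈ Finset.range n, (T (k + 1) ω - T k ω) • (V k ω : EuclideanSpace ℝ (Fin d)) +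
    (t - T n ω) • (V n ω : EuclideanSpace ℝ (Fin d)))

variable [MeasurableSpace Ω]

/-- The instants `T_k` of the changes of direction and the directions `V_k`, on a probability
space `(Ω, P)`, drive at time `t` the switching-phase random walk with indices `h, i, j` in
dimension `d`: the directions are independent, uniformly distributed on the unit sphere and
independent of the instants, and given that there are `n ≥ 1` changes of direction in `[0, t]`,
the durations `T_1 - T_0, …, T_n - T_{n-1}` have the generalized Dirichlet distribution with
the switching-phase parameters. -/
structure IsSwitchingWalk (d h i j : ℕ) (P : Measure Ω) (T : ℕ → Ω → ℝ)
    (V : ℕ → Ω → UnitSphere d) (t : ℝ) : Prop where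
  measurable_time : ∀ k, Measurable (T k)
  measurable_direction : ∀ k, Measurable (V k)
  time_zero : ∀ᵐ ω ∂P, T 0 ω = 0
  strictMono_time : ∀ᵐ ω ∂P, StrictMono fun k => T k ω
  law_direction : ∀ k, P.map (V k) = uniformSphere d
  indep_direction : iIndepFun V P
  indep_direction_time : IndepFun (fun ω k => V k ω) (fun ω k => T k ω) P
  law_duration : ∀ n : ℕ, 1 ≤ n → P {ω | numChanges T t ω = n} ≠ 0 →
    (P[|{ω | numChanges T t ω = n}]).map (fun ω (k : Fin n) => T (k + 1) ω - T k ω) =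
      generalizedDirichlet (switchA d j n) (switchB d h i j n) t

/-- The function
`Γ((n+1)(d/2-1) + j/2 + 1) / Γ(n(d/2-1) + j/2) · (c²t² - ‖x‖²)^{n(d/2-1) + j/2 - 1} /
(π^{d/2} (ct)^{2(n+1)(d/2-1) + j})`. -/
def walkDensity (d n j : ℕ) (c t : ℝ) (x : EuclideanSpace ℝ (Fin d)) : ℝ :=
  Real.Gamma (((n : ℝ) + 1) * ((d : ℝ) / 2 - 1) + (j : ℝ) / 2 + 1) /
      Real.Gamma ((n : ℝ) * ((d : ℝ) / 2 - 1) + (j : ℝ) / 2) *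
    ((c ^ 2 * t ^ 2 - ‖x‖ ^ 2) ^ ((n : ℝ) * ((d : ℝ) / 2 - 1) + (j : ℝ) / 2 - 1) /
      (Real.pi ^ ((d : ℝ) / 2) * (c * t) ^ (2 * ((n : ℝ) + 1) * ((d : ℝ) / 2 - 1) + (j : ℝ))))

end DirichletWalk

end

open DirichletWalk

noncomputable section

namespace DirichletWalk

/-! Generalized Dirichlet durations come from stick breaking: the first is a beta distributed
fraction `U` of the total, and the others split the remainder by an independent law of the same
family. Hence the endpoint at unit time and unit speed satisfies `X = U V + (1 - U) X'`, where `V`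
is uniform on the sphere, `X'` is the endpoint of a walk with one step fewer, and `U`, `V`, `X'` are
independent (`generalizedDirichlet_succ`, `endpointLaw_succ`).

If `U` is Beta`(a, b)`, expanding binomially gives, as formal series in `θ`, E(1 - ⟨θ, X⟩)^(-a-b) =
E(1 - ⟨θ, V⟩)^(-a) · E(1 - ⟨θ, X'⟩)^(-b). For an isotropic law with density proportional to (1 -
‖x‖²)^(κ-d/2-1), or for the sphere when κ = d/2, the series E(1 - ⟨θ, X⟩)^(-a) is F(a/2, (a+1)/2; κ;
‖θ‖²). A step therefore stays in this family as soon as a product of two such hypergeometric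
functions is a third one (`HypConv`).

This happens when they are elementary. For a = 2κ - 1 and a = 2κ they are powers of 1 - z; for a = κ
- 1 and a = κ they are powers of 2/(1 + √(1-z)), in the second case times (1-z)^(-1/2). The first j
steps are of the former kind, the later ones of the latter, and b_j is tuned to pass from one to the
other (`phase_step`). Induction from the last direction back to the first gives all moments of the
projections of the endpoint. A law of bounded support is determined by them
(`ext_of_inner_moments`), and the isotropic density on the ball of radius ct has the same ones. -/

/-! ### Convolution of polynomial sequences with a common difference equation -/

open Polynomial Finset in
/-- An abstract form of the convolution identities of Vandermonde and of Rothe and Hagen: two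
sequences of polynomials with the same difference equation. -/
theorem sum_antidiagonal_eval_mul_eval {A B : ℕ → ℝ[X]} {c s : ℝ}
    (hA : ∀ q x, (A (q + 1)).eval x - (A (q + 1)).eval (x - 1) = c * (A q).eval (x + s))
    (hB : ∀ q x, (B (q + 1)).eval x - (B (q + 1)).eval (x - 1) = c * (B q).eval (x + s))
    (hA0 : A 0 = 1) (hB0 : B 0 = 1) (hA1 : ∀ q, (A (q + 1)).eval 0 = 0) (q : ℕ) (x y : ℝ) :
    ∑ p ∈ antidiagonal q, (A p.1).eval x * (B p.2).eval y = (B q).eval (x + y) := by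
  induction q generalizing x y with
  | zero => simp [hA0, hB0]
  | succ q ih =>
    -- With `y` fixed, the defect is a polynomial in `x`. By the induction hypothesis and the two
    -- difference equations it has period 1; it vanishes at 0, hence at all naturals, hence
    -- identically.
    set D : ℝ[X] := ∑ p ∈ antidiagonal (q + 1), A p.1 * C ((B p.2).eval y) -
      (B (q + 1)).comp (X + C y) with hD
    have hDe : ∀ z, D.eval z = ∑ p ∈ antidiagonal (q + 1), (A p.1).eval z * (B p.2).eval y -
        (B (q + 1)).eval (z + y) := by
      intro z
      simp [hD, eval_finsetSum]
    have hstep : ∀ z, D.eval z = D.eval (z - 1) := by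
      intro z
      have h1 := hB q (z + y)
      have h2 : ∀ z, ∑ p ∈ antidiagonal (q + 1), (A p.1).eval z * (B p.2).eval y =
          (B (q + 1)).eval y + ∑ p ∈ antidiagonal q, (A (p.1 + 1)).eval z * (B p.2).eval y := by
        intro z
        rw [Nat.sum_antidiagonal_succ, hA0]
        simp
      have h3 : ∑ p ∈ antidiagonal q, (A (p.1 + 1)).eval z * (B p.2).eval y -
          ∑ p ∈ antidiagonal q, (A (p.1 + 1)).eval (z - 1) * (B p.2).eval y =
          c * (B q).eval (z + s + y) := by
        rw [← ih, ← sum_sub_distrib, mul_sum]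
        refine sum_congr rfl fun p _ => ?_
        rw [← sub_mul, hA, mul_assoc]
      rw [hDe, hDe, h2, h2]
      rw [show z - 1 + y = z + y - 1 by ring]
      rw [show z + s + y = z + y + s by ring] at h3
      linarith
    have hzero : ∀ m : ℕ, D.eval (m : ℝ) = 0 := by
      intro m
      induction m with
      | zero =>
        rw [hDe, Nat.sum_antidiagonal_succ, hA0]
        simp [hA1]
      | succ m ihm =>
        rw [hstep]
        simpa using ihm
    have hD0 : D = 0 := by
      refine eq_zero_of_infinite_isRoot D ((Set.infinite_range_of_injective
        (Nat.cast_injective (R := ℝ))).mono ?_)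
      rintro _ ⟨m, rfl⟩
      exact hzero m
    have := hDe x
    rw [hD0, eval_zero] at this
    linarith

/-! ### Rising factorials -/

/-- The rising factorial `x (x + 1) ⋯ (x + q - 1)`. -/
abbrev rise (x : ℝ) (q : ℕ) : ℝ := (ascPochhammer ℝ q).eval x

theorem rise_succ (x : ℝ) (q : ℕ) : rise x (q + 1) = rise x q * (x + q) := by
  simp [rise, ascPochhammer_succ_eval]

theorem rise_succ_left (x : ℝ) (q : ℕ) : rise x (q + 1) = x * rise (x + 1) q := by
  simp [rise, ascPochhammer_succ_left]

theorem rise_pos {x : ℝ} (hx : 0 < x) (q : ℕ) : 0 < rise x q := ascPochhammer_pos q x hx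

theorem rise_add (x : ℝ) (p q : ℕ) : rise x (p + q) = rise x p * rise (x + p) q := by
  simp [rise, ← ascPochhammer_mul]

theorem rise_double (x : ℝ) (q : ℕ) :
    rise (2 * x) (2 * q) = 4 ^ q * rise x q * rise (x + 1 / 2) q := by
  induction q with
  | zero => simp [rise]
  | succ q ih =>
    rw [show 2 * (q + 1) = 2 * q + 1 + 1 by ring]
    simp only [rise_succ, ih]
    push_cast
    ring

theorem factorial_double (q : ℕ) :
    ((2 * q).factorial : ℝ) = 4 ^ q * q.factorial * rise (1 / 2) q := by
  induction q with
  | zero => simp [rise]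
  | succ q ih =>
    rw [show 2 * (q + 1) = 2 * q + 1 + 1 by ring]
    simp only [Nat.factorial_succ, rise_succ, Nat.cast_mul, ih]
    push_cast
    ring

theorem rise_mul_Gamma {x : ℝ} (hx : 0 < x) (q : ℕ) :
    Real.Gamma (x + q) = rise x q * Real.Gamma x := by
  induction q with
  | zero => simp [rise]
  | succ q ih =>
    rw [Nat.cast_succ, ← add_assoc, Real.Gamma_add_one (by positivity), ih, rise_succ]
    ring

/-! ### Ball moments and hypergeometric coefficients -/

/-- The moments of the projection to a unit vector of an isotropic law in the unit ball with
density proportional to `(1 - ‖x‖ ^ 2) ^ (κ - d / 2 - 1)`. -/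
def ballMoment (κ : ℝ) (p : ℕ) : ℝ :=
  if Even p then rise (1 / 2) (p / 2) / rise κ (p / 2) else 0

theorem ballMoment_two_mul (κ : ℝ) (q : ℕ) :
    ballMoment κ (2 * q) = rise (1 / 2) q / rise κ q := by
  simp [ballMoment]

/-- The coefficients of the hypergeometric series `F(a / 2, (a + 1) / 2; κ; z)`. -/
def hypCoeff (a κ : ℝ) (q : ℕ) : ℝ := rise a (2 * q) / (4 ^ q * q.factorial * rise κ q)

/-- Since (2q)! = 4^q q! (1/2)_q, the numerator of the moment cancels. This makes the expectation of
(1 - ⟨θ, X⟩)^(-a) a hypergeometric series in ‖θ‖². -/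
theorem rise_mul_ballMoment_div_factorial (a κ : ℝ) (q : ℕ) :
    rise a (2 * q) * ballMoment κ (2 * q) / (2 * q).factorial = hypCoeff a κ q := by
  rw [ballMoment_two_mul, factorial_double, hypCoeff]
  have := rise_pos (x := 1 / 2) (by norm_num) q
  field_simp

/-- Duplication splits (2κ-1)_{2q} into 4^q (κ-1/2)_q (κ)_q and the last factor cancels. What
remains are the coefficients of (1-z)^(1/2-κ). -/
theorem hypCoeff_two_mul_sub_one {κ : ℝ} (hκ : 0 < κ) (q : ℕ) :
    hypCoeff (2 * κ - 1) κ q = rise (κ - 1 / 2) q / q.factorial := by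
  have h := rise_double (κ - 1 / 2) q
  rw [show 2 * (κ - 1 / 2) = 2 * κ - 1 by ring, sub_add_cancel] at h
  rw [hypCoeff, h]
  have := rise_pos hκ q
  field_simp

/-- The same cancellation, leaving the coefficients of (1-z)^(-κ-1/2). -/
theorem hypCoeff_two_mul {κ : ℝ} (hκ : 0 < κ) (q : ℕ) :
    hypCoeff (2 * κ) κ q = rise (κ + 1 / 2) q / q.factorial := by
  rw [hypCoeff, rise_double]
  have := rise_pos hκ q
  field_simp

/-! ### Vandermonde, Rothe and Hagen identities -/

open Polynomial in
/-- The polynomials `x ↦ (x)_q / q!`. -/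
def vandermondePoly (q : ℕ) : ℝ[X] := C (1 / (q.factorial : ℝ)) * ascPochhammer ℝ q

theorem vandermondePoly_eval (q : ℕ) (x : ℝ) :
    (vandermondePoly q).eval x = rise x q / q.factorial := by
  simp [vandermondePoly, rise, div_eq_inv_mul]

theorem vandermonde_rise (q : ℕ) (x y : ℝ) :
    ∑ p ∈ Finset.HasAntidiagonal.antidiagonal q, rise x p.1 / p.1.factorial * (rise y p.2 / p.2.factorial) =
      rise (x + y) q / q.factorial := by
  simp only [← vandermondePoly_eval]
  -- For the generating function G = (1-z)^(-x), replacing x by x - 1 multiplies by 1 - z, so the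
  -- difference is zG.
  have h : ∀ q x, (vandermondePoly (q + 1)).eval x - (vandermondePoly (q + 1)).eval (x - 1) =
      1 * (vandermondePoly q).eval (x + 0) := by
    intro q x
    simp only [vandermondePoly_eval, one_mul, add_zero]
    rw [rise_succ, rise_succ_left (x - 1), sub_add_cancel, Nat.factorial_succ]
    push_cast
    field_simp
    ring
  refine sum_antidiagonal_eval_mul_eval h h ?_ ?_ ?_ q x y
  · simp [vandermondePoly]
  · simp [vandermondePoly]
  · intro q
    simp [vandermondePoly_eval]

open Polynomial in
/-- The coefficients, as polynomials in `x`, of the power series in `z` of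
`(2 / (1 + √(1 - z))) ^ x`. -/
def rothePoly : ℕ → ℝ[X]
  | 0 => 1
  | q + 1 => C (1 / (4 ^ (q + 1) * ((q + 1).factorial : ℝ))) *
      (X * (ascPochhammer ℝ q).comp (X + C ((q : ℝ) + 2)))

open Polynomial in
/-- The coefficients, as polynomials in `x`, of the power series in `z` of
`(1 - z) ^ (-1 / 2) (2 / (1 + √(1 - z))) ^ x`. -/
def hagenPoly (q : ℕ) : ℝ[X] :=
  C (1 / (4 ^ q * (q.factorial : ℝ))) * (ascPochhammer ℝ q).comp (X + C ((q : ℝ) + 1))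

theorem rothePoly_succ_eval (q : ℕ) (x : ℝ) : (rothePoly (q + 1)).eval x =
    x * rise (x + q + 2) q / (4 ^ (q + 1) * (q + 1).factorial) := by
  simp [rothePoly, rise, div_eq_inv_mul, add_assoc]

theorem hagenPoly_eval (q : ℕ) (x : ℝ) : (hagenPoly q).eval x =
    rise (x + q + 1) q / (4 ^ q * q.factorial) := by
  simp [hagenPoly, rise, div_eq_inv_mul, add_assoc]

/-- B = 2/(1 + √(1-z)) solves B - 1 = (z/4) B². Multiplying by B^(x-1) gives B^x - B^(x-1) = (z/4)
B^(x+1), which is this recurrence for the coefficients. -/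
theorem rothePoly_difference (q : ℕ) (x : ℝ) :
    (rothePoly (q + 1)).eval x - (rothePoly (q + 1)).eval (x - 1) =
      1 / 4 * (rothePoly q).eval (x + 1) := by
  cases q with
  | zero => simp [rothePoly]; ring
  | succ q =>
    simp only [rothePoly_succ_eval]
    have h1 : rise (x + (q + 1 : ℕ) + 2) (q + 1) =
        rise (x + q + 3) q * (x + 2 * q + 3) := by
      rw [rise_succ]; push_cast; ring_nf
    have h2 : rise (x - 1 + (q + 1 : ℕ) + 2) (q + 1) = (x + q + 2) * rise (x + q + 3) q := by
      rw [rise_succ_left]; push_cast; ring_nf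
    have h3 : rise (x + 1 + q + 2) q = rise (x + q + 3) q := by ring_nf
    rw [h1, h2, h3, Nat.factorial_succ (q + 1)]
    push_cast
    field_simp
    ring

/-- The relation B^x - B^(x-1) = (z/4) B^(x+1) multiplied by (1-z)^(-1/2). -/
theorem hagenPoly_difference (q : ℕ) (x : ℝ) :
    (hagenPoly (q + 1)).eval x - (hagenPoly (q + 1)).eval (x - 1) =
      1 / 4 * (hagenPoly q).eval (x + 1) := by
  simp only [hagenPoly_eval]
  have h1 : rise (x + (q + 1 : ℕ) + 1) (q + 1) = rise (x + q + 2) q * (x + 2 * q + 2) := by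
    rw [rise_succ]; push_cast; ring_nf
  have h2 : rise (x - 1 + (q + 1 : ℕ) + 1) (q + 1) = (x + q + 1) * rise (x + q + 2) q := by
    rw [rise_succ_left]; push_cast; ring_nf
  have h3 : rise (x + 1 + q + 1) q = rise (x + q + 2) q := by ring_nf
  rw [h1, h2, h3, Nat.factorial_succ q]
  push_cast
  field_simp
  ring

/-- The factor (x+1)_q of (x)_{2q} cancels the denominator, so the coefficient becomes polynomial in
x and the periodicity argument applies. -/
theorem hypCoeff_eq_rothePoly {x : ℝ} (hx : 0 < x) (q : ℕ) :
    hypCoeff x (x + 1) q = (rothePoly q).eval x := by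
  cases q with
  | zero => simp [hypCoeff, rothePoly, rise]
  | succ q =>
    have h : rise x (2 * (q + 1)) = x * (rise (x + 1) (q + 1) * rise (x + q + 2) q) := by
      rw [show 2 * (q + 1) = (q + 1 + q) + 1 by ring, rise_succ_left, rise_add]
      push_cast; ring_nf
    rw [rothePoly_succ_eval, hypCoeff, h]
    have := rise_pos (x := x + 1) (by positivity) (q + 1)
    field_simp

theorem hypCoeff_eq_hagenPoly {x : ℝ} (hx : 0 < x) (q : ℕ) :
    hypCoeff (x + 1) (x + 1) q = (hagenPoly q).eval x := by
  have h : rise (x + 1) (2 * q) = rise (x + 1) q * rise (x + q + 1) q := by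
    rw [two_mul, rise_add]; ring_nf
  rw [hagenPoly_eval, hypCoeff, h]
  have := rise_pos (x := x + 1) (by positivity) q
  field_simp

/-- The identities between moments behind one step of the walk. -/
def HypConv (a κ₀ β κ₁ κ₂ : ℝ) : Prop :=
  ∀ q, ∑ p ∈ Finset.HasAntidiagonal.antidiagonal q, hypCoeff a κ₀ p.1 * hypCoeff β κ₁ p.2 = hypCoeff (a + β) κ₂ q

theorem hypConv_rothe {x y : ℝ} (hx : 0 < x) (hy : 0 < y) :
    HypConv x (x + 1) y (y + 1) (x + y + 1) := by
  intro q
  simp only [hypCoeff_eq_rothePoly hx, hypCoeff_eq_rothePoly hy,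
    hypCoeff_eq_rothePoly (add_pos hx hy)]
  exact sum_antidiagonal_eval_mul_eval rothePoly_difference rothePoly_difference rfl rfl
    (fun q => by simp [rothePoly_succ_eval]) q x y

theorem hypConv_hagen {x y : ℝ} (hx : 0 < x) (hy : 0 < y) :
    HypConv x (x + 1) (y + 1) (y + 1) (x + y + 1) := by
  intro q
  simp only [hypCoeff_eq_rothePoly hx, hypCoeff_eq_hagenPoly hy, ← add_assoc,
    hypCoeff_eq_hagenPoly (add_pos hx hy)]
  exact sum_antidiagonal_eval_mul_eval rothePoly_difference hagenPoly_difference rfl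
    (by simp [hagenPoly]) (fun q => by simp [rothePoly_succ_eval]) q x y

/-- Both factors are powers of 1 - z, so the exponents add; `h` selects the exponent 1/2 - κ₁ or
-1/2 - κ₁ of the second one. -/
theorem hypConv_vandermonde {κ₀ κ₁ : ℝ} (h₀ : 1 / 2 < κ₀) (h₁ : 0 < κ₁) {h : ℕ} (hh : h ≤ 1) :
    HypConv (2 * κ₀ - 1) κ₀ (2 * κ₁ - 1 + h) κ₁ (κ₀ + κ₁ - 1 / 2) := by
  intro q
  have h₂ : 0 < κ₀ + κ₁ - 1 / 2 := by linarith
  have h₃ : 0 < κ₀ := by linarith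
  interval_cases h
  · rw [show 2 * κ₀ - 1 + (2 * κ₁ - 1 + (0 : ℕ)) = 2 * (κ₀ + κ₁ - 1 / 2) - 1 by push_cast; ring,
      show 2 * κ₁ - 1 + (0 : ℕ) = 2 * κ₁ - 1 by simp]
    simp only [hypCoeff_two_mul_sub_one h₃, hypCoeff_two_mul_sub_one h₁,
      hypCoeff_two_mul_sub_one h₂, vandermonde_rise]
    ring_nf
  · rw [show 2 * κ₀ - 1 + (2 * κ₁ - 1 + (1 : ℕ)) = 2 * (κ₀ + κ₁ - 1 / 2) by push_cast; ring,
      show 2 * κ₁ - 1 + (1 : ℕ) = 2 * κ₁ by simp]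
    simp only [hypCoeff_two_mul_sub_one h₃, hypCoeff_two_mul h₁,
      hypCoeff_two_mul h₂, vandermonde_rise]
    ring_nf

theorem sum_antidiagonal_two_mul {f : ℕ → ℕ → ℝ} (hf : ∀ p q, ¬ Even p → f p q = 0) (n : ℕ) :
    ∑ p ∈ Finset.HasAntidiagonal.antidiagonal (2 * n), f p.1 p.2 =
      ∑ p ∈ Finset.HasAntidiagonal.antidiagonal n, f (2 * p.1) (2 * p.2) := by
  rw [← Finset.sum_filter_of_ne (p := fun p => Even p.1)
    (fun p _ h => by by_contra h'; exact h (hf _ _ h'))]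
  symm
  refine Finset.sum_nbij (fun p => (2 * p.1, 2 * p.2)) ?_ ?_ ?_ (fun _ _ => rfl)
  · rintro ⟨p, q⟩ h
    simp only [Finset.HasAntidiagonal.mem_antidiagonal, Finset.mem_filter] at h ⊢
    exact ⟨by omega, by simp⟩
  · rintro ⟨p, q⟩ _ ⟨p', q'⟩ _ h
    simp only [Prod.mk.injEq] at h ⊢
    omega
  · rintro ⟨p, q⟩ h
    simp only [Finset.coe_filter, Finset.HasAntidiagonal.mem_antidiagonal, Set.mem_ofPred_eq] at h
    obtain ⟨h, r, hr⟩ := h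
    refine ⟨(r, n - r), ?_, ?_⟩
    · simp only [Finset.mem_coe, Finset.HasAntidiagonal.mem_antidiagonal]; omega
    · simp only [Prod.mk.injEq]; omega

/-- A step of the walk, at the level of moments. -/
theorem HypConv.sum_moments {a κ₀ β κ₁ κ₂ : ℝ} (h : HypConv a κ₀ β κ₁ κ₂) (n : ℕ) :
    ∑ p ∈ Finset.HasAntidiagonal.antidiagonal n, (rise a p.1 * ballMoment κ₀ p.1 / p.1.factorial) *
        (rise β p.2 * ballMoment κ₁ p.2 / p.2.factorial) =
      rise (a + β) n * ballMoment κ₂ n / n.factorial := by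
  rcases Nat.even_or_odd' n with ⟨m, rfl | rfl⟩
  · rw [sum_antidiagonal_two_mul (f := fun p q => (rise a p * ballMoment κ₀ p / p.factorial) *
        (rise β q * ballMoment κ₁ q / q.factorial))
        (fun p q hp => by simp [ballMoment, hp])]
    simp only [rise_mul_ballMoment_div_factorial]
    exact h m
  · rw [ballMoment, if_neg (Nat.not_even_two_mul_add_one m), mul_zero, zero_div]
    refine Finset.sum_eq_zero fun p hp => ?_
    rw [Finset.HasAntidiagonal.mem_antidiagonal] at hp
    have : ¬ (Even p.1 ∧ Even p.2) := by
      rintro ⟨⟨r, hr⟩, ⟨s, hs⟩⟩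
      omega
    rw [not_and_or] at this
    rcases this with h' | h' <;> simp [ballMoment, h']

/-! ### Polar coordinates; moments on the sphere and in the ball -/

theorem betaPDFReal_nonneg {a b : ℝ} (ha : 0 < a) (hb : 0 < b) (x : ℝ) :
    0 ≤ betaPDFReal a b x := by
  by_cases h : 0 < x ∧ x < 1
  · exact (betaPDFReal_pos h.1 h.2 ha hb).le
  · simp [betaPDFReal, h]

theorem integral_betaPDFReal_eq_one {a b : ℝ} (ha : 0 < a) (hb : 0 < b) :
    ∫ x, betaPDFReal a b x = 1 := by
  rw [integral_eq_lintegral_of_nonneg_ae (Filter.Eventually.of_forall (betaPDFReal_nonneg ha hb))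
    (measurable_betaPDFReal a b).aestronglyMeasurable]
  change (∫⁻ x, betaPDF a b x).toReal = 1
  rw [lintegral_betaPDF_eq_one ha hb, ENNReal.toReal_one]

/-- Polar coordinates for the projections to a line. -/
theorem integral_norm_mul_inner_pow {d : ℕ} (hd : 0 < d) (g : ℝ → ℝ)
    (θ : EuclideanSpace ℝ (Fin d)) (p : ℕ) :
    ∫ x : EuclideanSpace ℝ (Fin d), g ‖x‖ * inner ℝ x θ ^ p =
      (∫ v : UnitSphere d, inner ℝ (v : EuclideanSpace ℝ (Fin d)) θ ^ p ∂(volume.toSphere)) *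
        ∫ r in Set.Ioi (0 : ℝ), r ^ (d - 1 + p) * g r := by
  have : Nonempty (Fin d) := ⟨⟨0, hd⟩⟩
  have h1 : ∫ x : EuclideanSpace ℝ (Fin d), g ‖x‖ * inner ℝ x θ ^ p =
      ∫ x : ({0}ᶜ : Set (EuclideanSpace ℝ (Fin d))), g ‖x.1‖ * inner ℝ x.1 θ ^ p
        ∂(Measure.comap Subtype.val volume) := by
    rw [integral_subtype_comap (measurableSet_singleton _).compl
      fun x => g ‖x‖ * inner ℝ x θ ^ p, restrict_compl_singleton]
  have h2 := (volume : Measure (EuclideanSpace ℝ (Fin d))).measurePreserving_homeomorphUnitSphereProd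
    |>.integral_comp (Homeomorph.measurableEmbedding _)
      (fun q => inner ℝ (q.1 : EuclideanSpace ℝ (Fin d)) θ ^ p * (q.2.1 ^ p * g q.2.1))
  have h3 : ∀ x : ({0}ᶜ : Set (EuclideanSpace ℝ (Fin d))),
      g ‖x.1‖ * inner ℝ x.1 θ ^ p =
      inner ℝ ((homeomorphUnitSphereProd _ x).1 : EuclideanSpace ℝ (Fin d)) θ ^ p *
        ((homeomorphUnitSphereProd _ x).2.1 ^ p * g (homeomorphUnitSphereProd _ x).2.1) := by
    intro x
    have hx : ‖x.1‖ ≠ 0 := norm_ne_zero_iff.2 x.2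
    rw [homeomorphUnitSphereProd_apply_fst_coe, homeomorphUnitSphereProd_apply_snd_coe,
      real_inner_smul_left, mul_pow, inv_pow]
    field_simp
  rw [h1, integral_congr_ae (Filter.Eventually.of_forall h3), h2,
    integral_prod_mul (fun v : UnitSphere d => inner ℝ (v : EuclideanSpace ℝ (Fin d)) θ ^ p)
      (fun r : Set.Ioi (0 : ℝ) => r.1 ^ p * g r.1)]
  congr 1
  simp only [Measure.volumeIoiPow, ENNReal.ofReal]
  rw [integral_withDensity_eq_integral_smul,
    integral_subtype_comap measurableSet_Ioi
      fun a => Real.toNNReal (a ^ (Module.finrank ℝ (EuclideanSpace ℝ (Fin d)) - 1)) •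
        (a ^ p * g a)]
  · refine setIntegral_congr_fun measurableSet_Ioi fun x hx => ?_
    simp only [finrank_euclideanSpace, Fintype.card_fin]
    rw [NNReal.smul_def, Real.coe_toNNReal _ (pow_nonneg (le_of_lt hx) _), smul_eq_mul, pow_add]
    ring
  · exact (measurable_subtype_coe.pow_const _).real_toNNReal

theorem integral_Ioi_pow_mul_exp_neg_sq (p : ℕ) :
    ∫ x in Set.Ioi (0 : ℝ), x ^ p * Real.exp (-x ^ 2) = 1 / 2 * Real.Gamma ((p + 1) / 2) := by
  have h := integral_rpow_mul_exp_neg_rpow (p := 2) (q := p) (by norm_num)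
    (by have : (0 : ℝ) ≤ p := p.cast_nonneg
        linarith)
  rw [← h]
  refine setIntegral_congr_fun measurableSet_Ioi fun x _ => ?_
  rw [Real.rpow_natCast, Real.rpow_two]

theorem integral_pow_mul_exp_neg_sq (p : ℕ) :
    ∫ x : ℝ, x ^ p * Real.exp (-x ^ 2) = if Even p then Real.Gamma ((p + 1) / 2) else 0 := by
  split_ifs with hp
  · have h : ∀ x : ℝ, x ^ p * Real.exp (-x ^ 2) = |x| ^ p * Real.exp (-|x| ^ 2) := by
      intro x
      rw [hp.pow_abs, sq_abs]
    rw [integral_congr_ae (Filter.Eventually.of_forall h),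
      integral_comp_abs (f := fun x => x ^ p * Real.exp (-x ^ 2)),
      integral_Ioi_pow_mul_exp_neg_sq]
    ring
  · have h := integral_neg_eq_self (fun x : ℝ => x ^ p * Real.exp (-x ^ 2)) volume
    have h' : ∀ x : ℝ, (-x) ^ p * Real.exp (-(-x) ^ 2) = -(x ^ p * Real.exp (-x ^ 2)) := by
      intro x
      rw [(Nat.not_even_iff_odd.1 hp).neg_pow, neg_sq, neg_mul]
    rw [integral_congr_ae (Filter.Eventually.of_forall h'), integral_neg] at h
    linarith

/-- The moments of a projection of the rotation invariant Gaussian measure. -/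
theorem integral_exp_neg_norm_sq_mul_inner_pow {d : ℕ} (hd : 0 < d)
    (θ : EuclideanSpace ℝ (Fin d)) (p : ℕ) :
    ∫ x : EuclideanSpace ℝ (Fin d), Real.exp (-‖x‖ ^ 2) * inner ℝ x θ ^ p =
      ‖θ‖ ^ p * (∫ x : ℝ, x ^ p * Real.exp (-x ^ 2)) * √Real.pi ^ (d - 1) := by
  obtain ⟨m, rfl⟩ : ∃ m, d = m + 1 := ⟨d - 1, by omega⟩
  set e : EuclideanSpace ℝ (Fin (m + 1)) := EuclideanSpace.single 0 ‖θ‖ with he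
  have hnorm : ‖e‖ = ‖θ‖ := by simp [he]
  -- This reflection exchanges `θ` with the multiple `e` of the first basis vector of the same norm;
  -- the Gaussian weight is invariant, so the integral becomes a product over coordinates.
  set L := (ℝ ∙ (e - θ))ᗮ.reflection with hL
  have hLe : L e = θ := Submodule.reflection_sub hnorm
  have h1 : ∫ x : EuclideanSpace ℝ (Fin (m + 1)), Real.exp (-‖x‖ ^ 2) * inner ℝ x θ ^ p =
      ∫ x : EuclideanSpace ℝ (Fin (m + 1)), Real.exp (-‖x‖ ^ 2) * inner ℝ x e ^ p := by
    rw [← L.measurePreserving.integral_comp L.toHomeomorph.measurableEmbedding]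
    congr 1
    ext x
    rw [L.norm_map, ← hLe, L.inner_map_map]
  have h2 : ∀ x : Fin (m + 1) → ℝ,
      Real.exp (-‖WithLp.toLp 2 x‖ ^ 2) * inner ℝ (WithLp.toLp 2 x) e ^ p =
      ∏ k, (if k = 0 then (‖θ‖ * x k) ^ p else 1) * Real.exp (-x k ^ 2) := by
    intro x
    rw [Finset.prod_mul_distrib, ← Real.exp_sum, EuclideanSpace.norm_sq_eq, mul_comm,
      Finset.sum_neg_distrib, Finset.prod_ite_eq' Finset.univ (0 : Fin (m + 1))]
    simp [he, EuclideanSpace.inner_single_right]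
  rw [h1, ← (PiLp.volume_preserving_toLp (Fin (m + 1))).integral_comp
    (MeasurableEquiv.toLp 2 _).measurableEmbedding]
  simp only [h2]
  rw [integral_fintype_prod_volume_eq_prod
    (fun (k : Fin (m + 1)) (y : ℝ) => (if k = 0 then (‖θ‖ * y) ^ p else 1) * Real.exp (-y ^ 2)),
    Fin.prod_univ_succ]
  have h3 : ∫ x : ℝ, Real.exp (-x ^ 2) = √Real.pi := by
    simpa using integral_gaussian 1
  simp only [if_true, Fin.succ_ne_zero, if_false, one_mul, h3, Finset.prod_const,
    Finset.card_univ, Fintype.card_fin, mul_pow, mul_assoc, integral_const_mul]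
  simp

theorem ballMoment_eq_Gamma {κ : ℝ} (hκ : 0 < κ) (p : ℕ) :
    ballMoment κ p = (if Even p then Real.Gamma ((p + 1) / 2) else 0) / √Real.pi *
      (Real.Gamma κ / Real.Gamma (κ + p / 2)) := by
  rcases Nat.even_or_odd' p with ⟨q, rfl | rfl⟩
  · rw [ballMoment_two_mul, if_pos (even_two_mul q)]
    rw [show (((2 * q : ℕ) : ℝ) + 1) / 2 = 1 / 2 + q by push_cast; ring,
      show ((2 * q : ℕ) : ℝ) / 2 = q by push_cast; ring, rise_mul_Gamma (by norm_num),
      rise_mul_Gamma hκ, Real.Gamma_one_half_eq]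
    have h1 := Real.Gamma_pos_of_pos hκ
    have h2 := rise_pos hκ q
    have h3 : 0 < √Real.pi := Real.sqrt_pos.2 Real.pi_pos
    field_simp
  · simp [ballMoment]

/-- The surface area of the unit sphere. -/
def sphereArea (d : ℕ) : ℝ := 2 * Real.pi ^ ((d : ℝ) / 2) / Real.Gamma ((d : ℝ) / 2)

theorem sphereArea_pos {d : ℕ} (hd : 0 < d) : 0 < sphereArea d := by
  have : 0 < Real.Gamma ((d : ℝ) / 2) := Real.Gamma_pos_of_pos (by positivity)
  unfold sphereArea
  positivity

/-- In polar coordinates a Gaussian integral is the spherical moment times a radial Gamma integral,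
while in Cartesian coordinates it factorizes. Comparing the two gives the spherical moment. -/
theorem integral_toSphere_inner_pow {d : ℕ} (hd : 0 < d) (θ : EuclideanSpace ℝ (Fin d)) (p : ℕ) :
    ∫ v : UnitSphere d, inner ℝ (v : EuclideanSpace ℝ (Fin d)) θ ^ p ∂(volume.toSphere) =
      sphereArea d * (‖θ‖ ^ p * ballMoment (d / 2) p) := by
  have hd' : (0 : ℝ) < d / 2 := by positivity
  have h1 := integral_norm_mul_inner_pow hd (fun r => Real.exp (-r ^ 2)) θ p
  rw [integral_exp_neg_norm_sq_mul_inner_pow hd, integral_pow_mul_exp_neg_sq,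
    integral_Ioi_pow_mul_exp_neg_sq] at h1
  rw [ballMoment_eq_Gamma hd', sphereArea]
  have hcast : (((d - 1 + p : ℕ) : ℝ) + 1) / 2 = d / 2 + p / 2 := by
    rw [Nat.cast_add, Nat.cast_sub hd]; push_cast; ring
  rw [hcast] at h1
  have hg : 0 < Real.Gamma ((d : ℝ) / 2 + p / 2) := Real.Gamma_pos_of_pos (by positivity)
  have hg' : 0 < Real.Gamma ((d : ℝ) / 2) := Real.Gamma_pos_of_pos hd'
  have hpi : Real.pi ^ ((d : ℝ) / 2) = √Real.pi ^ (d - 1) * √Real.pi := by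
    rw [← pow_succ, Nat.sub_add_cancel hd, Real.sqrt_eq_rpow, ← Real.rpow_natCast,
      ← Real.rpow_mul Real.pi_pos.le]
    ring_nf
  have h3 : 0 < √Real.pi := Real.sqrt_pos.2 Real.pi_pos
  rw [hpi]
  field_simp
  field_simp at h1
  linarith

theorem toSphere_real_univ {d : ℕ} (hd : 0 < d) :
    (volume : Measure (EuclideanSpace ℝ (Fin d))).toSphere.real Set.univ = sphereArea d := by
  have h := integral_toSphere_inner_pow hd 0 0
  simpa [ballMoment, rise] using h

theorem isProbabilityMeasure_uniformSphere {d : ℕ} (hd : 0 < d) :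
    IsProbabilityMeasure (uniformSphere d) := by
  have : Nonempty (Fin d) := ⟨⟨0, hd⟩⟩
  refine ⟨?_⟩
  rw [uniformSphere, Measure.smul_apply, smul_eq_mul]
  exact ENNReal.inv_mul_cancel (Measure.measure_univ_ne_zero.2 (Measure.toSphere_ne_zero _)) (measure_ne_top _ _)

theorem integral_uniformSphere_inner_pow {d : ℕ} (hd : 0 < d) (θ : EuclideanSpace ℝ (Fin d))
    (p : ℕ) : ∫ v, inner ℝ (v : EuclideanSpace ℝ (Fin d)) θ ^ p ∂(uniformSphere d) =
      ‖θ‖ ^ p * ballMoment (d / 2) p := by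
  rw [uniformSphere, integral_smul_measure, integral_toSphere_inner_pow hd, ENNReal.toReal_inv,
    ← measureReal_def, toSphere_real_univ hd, smul_eq_mul]
  have := sphereArea_pos hd
  field_simp

/-- The substitution u = (r/R)² turns the integrand into a multiple of a beta density of total mass
1. -/
theorem integral_Ioi_pow_mul_indicator {R β : ℝ} (hR : 0 < R) (hβ : 0 < β) (m : ℕ) :
    ∫ r in Set.Ioi (0 : ℝ), r ^ m * (Set.Iio R).indicator (fun r => (R ^ 2 - r ^ 2) ^ (β - 1)) r =
      R ^ (m + 1 + 2 * (β - 1)) / 2 * beta ((m + 1) / 2) β := by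
  have hm : (0 : ℝ) < ((m : ℝ) + 1) / 2 := by positivity
  have hb := beta_pos hm hβ
  have h1 : ∫ u in Set.Ioi (0 : ℝ), betaPDFReal ((m + 1) / 2) β u = 1 := by
    rw [setIntegral_eq_integral_of_forall_compl_eq_zero, integral_betaPDFReal_eq_one hm hβ]
    intro x hx
    rw [betaPDFReal, if_neg (fun h => hx h.1)]
  have h2 := integral_comp_rpow_Ioi (betaPDFReal ((m + 1) / 2) β) (p := 2) (by norm_num)
  have h3 := integral_comp_mul_left_Ioi
    (fun x => (|2| * x ^ ((2 : ℝ) - 1)) • betaPDFReal ((m + 1) / 2) β (x ^ (2 : ℝ))) 0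
    (inv_pos.2 hR)
  rw [mul_zero, h2, h1, inv_inv, smul_eq_mul, mul_one] at h3
  have h4 : ∀ r ∈ Set.Ioi (0 : ℝ),
      r ^ m * (Set.Iio R).indicator (fun r => (R ^ 2 - r ^ 2) ^ (β - 1)) r =
      R ^ (m + 2 * (β - 1)) / 2 * beta ((m + 1) / 2) β *
        ((|2| * (R⁻¹ * r) ^ ((2 : ℝ) - 1)) • betaPDFReal ((m + 1) / 2) β ((R⁻¹ * r) ^ (2 : ℝ))) := by
    intro r hr
    rw [Set.mem_Ioi] at hr
    have hpos : 0 < R⁻¹ * r := by positivity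
    rw [Real.rpow_two, betaPDFReal]
    by_cases hrR : r < R
    · have hlt : R⁻¹ * r < 1 := by rw [inv_mul_lt_iff₀ hR]; linarith
      have hsq : R⁻¹ ^ 2 * r ^ 2 < 1 := by rw [← mul_pow]; nlinarith
      rw [Set.indicator_of_mem (by exact hrR), if_pos ⟨by positivity, by rw [mul_pow]; exact hsq⟩]
      have e1 : R ^ 2 - r ^ 2 = R ^ 2 * (1 - (R⁻¹ * r) ^ 2) := by field_simp
      have e2 : (R ^ 2) ^ (β - 1) = R ^ (2 * (β - 1)) := by
        rw [← Real.rpow_two, ← Real.rpow_mul hR.le]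
      have e3 : ((R⁻¹ * r) ^ 2) ^ (((m : ℝ) + 1) / 2 - 1) * (R⁻¹ * r) = R⁻¹ ^ m * r ^ m := by
        rw [← Real.rpow_two, ← Real.rpow_mul hpos.le]
        nth_rewrite 2 [← Real.rpow_one (R⁻¹ * r)]
        rw [← Real.rpow_add hpos, ← mul_pow, ← Real.rpow_natCast]
        ring_nf
      rw [e1, Real.mul_rpow (by positivity) (by rw [mul_pow]; linarith), e2,
        Real.rpow_add hR, Real.rpow_natCast]
      norm_num
      calc r ^ m * (R ^ (2 * (β - 1)) * (1 - (R⁻¹ * r) ^ 2) ^ (β - 1))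
        _ = R ^ m * (R⁻¹ ^ m * r ^ m) * R ^ (2 * (β - 1)) * (1 - (R⁻¹ * r) ^ 2) ^ (β - 1) := by
          rw [inv_pow]; field_simp
        _ = _ := by
          rw [← e3]
          field_simp
    · rw [Set.indicator_of_notMem (by exact hrR), if_neg]
      · simp
      · rintro ⟨-, h⟩
        have : 1 ≤ R⁻¹ * r := by rw [le_inv_mul_iff₀ hR]; linarith
        nlinarith
  rw [setIntegral_congr_fun measurableSet_Ioi h4, integral_const_mul, h3,
    show (m : ℝ) + 1 + 2 * (β - 1) = (m + 2 * (β - 1)) + 1 by ring, Real.rpow_add_one hR.ne']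
  ring

/-- The moments of the isotropic law in a ball with density proportional to
`(R ^ 2 - ‖x‖ ^ 2) ^ (β - 1)`. -/
theorem integral_ball_indicator_mul_inner_pow {d : ℕ} (hd : 0 < d) {R β C : ℝ} (hR : 0 < R)
    (hβ : 0 < β)
    (hC : C * R ^ (d + 2 * (β - 1)) * Real.pi ^ ((d : ℝ) / 2) * Real.Gamma β =
      Real.Gamma (d / 2 + β))
    (θ : EuclideanSpace ℝ (Fin d)) (p : ℕ) :
    ∫ x : EuclideanSpace ℝ (Fin d), (Metric.ball 0 R).indicator
        (fun x => C * (R ^ 2 - ‖x‖ ^ 2) ^ (β - 1)) x * inner ℝ x θ ^ p =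
      R ^ p * (‖θ‖ ^ p * ballMoment (d / 2 + β) p) := by
  have hd' : (0 : ℝ) < d / 2 := by positivity
  have h1 := integral_norm_mul_inner_pow hd
    (fun r => (Set.Iio R).indicator (fun r => (R ^ 2 - r ^ 2) ^ (β - 1)) r) θ p
  rw [integral_toSphere_inner_pow hd, integral_Ioi_pow_mul_indicator hR hβ] at h1
  have h2 : ∀ x : EuclideanSpace ℝ (Fin d), (Metric.ball 0 R).indicator
        (fun x => C * (R ^ 2 - ‖x‖ ^ 2) ^ (β - 1)) x * inner ℝ x θ ^ p =
      C * ((Set.Iio R).indicator (fun r => (R ^ 2 - r ^ 2) ^ (β - 1)) ‖x‖ * inner ℝ x θ ^ p) := by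
    intro x
    simp only [Set.indicator, Metric.mem_ball, dist_zero_right, Set.mem_Iio]
    split_ifs <;> ring
  simp only [h2]
  rw [integral_const_mul, h1, ballMoment_eq_Gamma hd', ballMoment_eq_Gamma (by positivity),
    sphereArea, beta]
  have hcast : (((d - 1 + p : ℕ) : ℝ) + 1) = d + p := by
    rw [Nat.cast_add, Nat.cast_sub hd]; push_cast; ring
  have hpow : R ^ ((d : ℝ) + p + 2 * (β - 1)) = R ^ (d + 2 * (β - 1)) * R ^ p := by
    rw [← Real.rpow_natCast R p, ← Real.rpow_add hR]; ring_nf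
  rw [hcast, hpow, ← hC, show ((d : ℝ) + p) / 2 = d / 2 + p / 2 by ring,
    show (d : ℝ) / 2 + p / 2 + β = d / 2 + β + p / 2 by ring]
  have hg : 0 < Real.Gamma ((d : ℝ) / 2 + p / 2) := Real.Gamma_pos_of_pos (by positivity)
  have hg' : 0 < Real.Gamma ((d : ℝ) / 2) := Real.Gamma_pos_of_pos hd'
  field_simp

/-! ### Determinacy by moments of projections -/

/-- A finite measure with bounded support on a Euclidean space is determined by the moments of
its one-dimensional projections. -/
theorem ext_of_inner_moments {d : ℕ} {μ ν : Measure (EuclideanSpace ℝ (Fin d))}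
    [IsFiniteMeasure μ] [IsFiniteMeasure ν] {R : ℝ} (hμ : ∀ᵐ x ∂μ, ‖x‖ ≤ R)
    (hν : ∀ᵐ x ∂ν, ‖x‖ ≤ R)
    (h : ∀ (θ : EuclideanSpace ℝ (Fin d)) (p : ℕ),
      ∫ x, inner ℝ x θ ^ p ∂μ = ∫ x, inner ℝ x θ ^ p ∂ν) : μ = ν := by
  -- The moments sum to the characteristic function: the exponential series may be integrated
  -- termwise, its terms being dominated by (R‖θ‖)^p / p!.
  have key : ∀ (ρ : Measure (EuclideanSpace ℝ (Fin d))) [IsFiniteMeasure ρ]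
      (_ : ∀ᵐ x ∂ρ, ‖x‖ ≤ R) (θ : EuclideanSpace ℝ (Fin d)),
      HasSum (fun p : ℕ => Complex.I ^ p / (p.factorial : ℂ) *
        ((∫ x, inner ℝ x θ ^ p ∂ρ : ℝ) : ℂ)) (charFun ρ θ) := by
    intro ρ _ hρ θ
    have hF : ∀ p : ℕ, Complex.I ^ p / (p.factorial : ℂ) * ((∫ x, inner ℝ x θ ^ p ∂ρ : ℝ) : ℂ) =
        ∫ x, ((inner ℝ x θ : ℝ) * Complex.I : ℂ) ^ p / (p.factorial : ℂ) ∂ρ := by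
      intro p
      rw [← integral_complex_ofReal, ← integral_const_mul]
      congr 1
      ext x
      push_cast
      ring
    simp only [hF, charFun_apply]
    refine hasSum_integral_of_dominated_convergence
      (fun p _ => (R * ‖θ‖) ^ p / p.factorial) (fun p => ?_) (fun p => ?_) ?_ ?_ ?_
    · exact Continuous.aestronglyMeasurable (by fun_prop)
    · filter_upwards [hρ] with x hx
      rw [norm_div, norm_pow, norm_mul, Complex.norm_I, mul_one, Complex.norm_real,
        Complex.norm_natCast]
      gcongr
      exact (norm_inner_le_norm x θ).trans (by gcongr)
    · exact Filter.Eventually.of_forall fun _ => Real.summable_pow_div_factorial _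
    · exact integrable_const _
    · refine Filter.Eventually.of_forall fun x => ?_
      rw [Complex.exp_eq_exp_ℂ]
      exact NormedSpace.expSeries_div_hasSum_exp _
  refine Measure.ext_of_charFun (funext fun θ => ?_)
  have h1 := key μ hμ θ
  simp only [h] at h1
  exact h1.unique (key ν hν θ)

/-! ### Beta moments and one step of the walk -/

theorem measurable_betaPDF (a b : ℝ) : Measurable (betaPDF a b) :=
  (measurable_betaPDFReal a b).ennreal_ofReal

theorem ae_betaMeasure_mem_Ioo (a b : ℝ) : ∀ᵐ u ∂(betaMeasure a b), 0 < u ∧ u < 1 := by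
  rw [betaMeasure, ae_withDensity_iff (measurable_betaPDF a b)]
  refine Filter.Eventually.of_forall fun u hu => ?_
  by_contra h
  simp [betaPDF, betaPDFReal, h] at hu

theorem beta_add_nat {a b : ℝ} (ha : 0 < a) (hb : 0 < b) (p q : ℕ) :
    beta (a + p) (b + q) = rise a p * rise b q / rise (a + b) (p + q) * beta a b := by
  have hg := Real.Gamma_pos_of_pos (add_pos ha hb)
  have hr := rise_pos (add_pos ha hb) (p + q)
  rw [beta, beta, rise_mul_Gamma ha, rise_mul_Gamma hb,
    show a + p + (b + q) = a + b + (p + q : ℕ) by push_cast; ring, rise_mul_Gamma (add_pos ha hb)]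
  field_simp

/-- The weight u^p (1-u)^q turns the beta density into a multiple of the one with parameters a + p,
b + q. -/
theorem integral_betaMeasure_pow_mul_pow {a b : ℝ} (ha : 0 < a) (hb : 0 < b) (p q : ℕ) :
    ∫ u, u ^ p * (1 - u) ^ q ∂(betaMeasure a b) =
      rise a p * rise b q / rise (a + b) (p + q) := by
  have h0 := beta_pos ha hb
  rw [betaMeasure, integral_withDensity_eq_integral_toReal_smul
    (measurable_betaPDF a b) (Filter.Eventually.of_forall
      fun _ => ENNReal.ofReal_lt_top)]
  have h : ∀ u, (betaPDF a b u).toReal • (u ^ p * (1 - u) ^ q) =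
      rise a p * rise b q / rise (a + b) (p + q) * betaPDFReal (a + p) (b + q) u := by
    intro u
    rw [betaPDF, ENNReal.toReal_ofReal (betaPDFReal_nonneg ha hb u), smul_eq_mul]
    simp only [betaPDFReal]
    split_ifs with hu
    · have h1 : 0 < 1 - u := by linarith [hu.2]
      have hp := rise_pos ha p
      have hq := rise_pos hb q
      have hpq := rise_pos (add_pos ha hb) (p + q)
      rw [beta_add_nat ha hb, show a + p - 1 = a - 1 + p by ring,
        show b + q - 1 = b - 1 + q by ring, Real.rpow_add_natCast hu.1.ne',
        Real.rpow_add_natCast h1.ne']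
      field_simp
    · simp
  rw [integral_congr_ae (Filter.Eventually.of_forall h), integral_const_mul,
    integral_betaPDFReal_eq_one (by positivity) (by positivity), mul_one]

variable {d : ℕ}

/-- A law in the unit ball of `ℝ^d` whose projections have the moments of the isotropic law with
density proportional to `(1 - ‖x‖ ^ 2) ^ (κ - d / 2 - 1)`. -/
structure HasBallMoments (κ : ℝ) (μ : Measure (EuclideanSpace ℝ (Fin d))) : Prop where
  isProbabilityMeasure : IsProbabilityMeasure μ
  norm_le : ∀ᵐ x ∂μ, ‖x‖ ≤ 1
  moment : ∀ θ p, ∫ x, inner ℝ x θ ^ p ∂μ = ‖θ‖ ^ p * ballMoment κ p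

/-- One step of the walk: move in a uniform direction for a beta distributed fraction of the
time, then follow a path with endpoint distributed according to `Λ`. -/
def stepLaw (a b : ℝ) (Λ : Measure (EuclideanSpace ℝ (Fin d))) :
    Measure (EuclideanSpace ℝ (Fin d)) :=
  ((betaMeasure a b).prod ((uniformSphere d).prod Λ)).map
    fun q => q.1 • (q.2.1 : EuclideanSpace ℝ (Fin d)) + (1 - q.1) • q.2.2

/-- After the binomial expansion independence factors each term. The beta moments supply (a)_p (b)_q
/ (a+b)_n, so the n-th moment is n! / (a+b)_n times the convolution evaluated by
`HypConv.sum_moments`. -/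
theorem HasBallMoments.stepLaw {a b κ κ' : ℝ} {Λ : Measure (EuclideanSpace ℝ (Fin d))}
    (hd : 0 < d) (ha : 0 < a) (hb : 0 < b) (h : HasBallMoments κ Λ)
    (hc : HypConv a (d / 2) b κ κ') : HasBallMoments κ' (stepLaw a b Λ) := by
  have := h.isProbabilityMeasure
  have := isProbabilityMeasure_uniformSphere hd
  have := isProbabilityMeasureBeta ha hb
  have hm : Measurable fun q : ℝ × UnitSphere d × EuclideanSpace ℝ (Fin d) =>
      q.1 • (q.2.1 : EuclideanSpace ℝ (Fin d)) + (1 - q.1) • q.2.2 := by fun_prop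
  refine ⟨Measure.isProbabilityMeasure_map hm.aemeasurable, ?_, fun θ n => ?_⟩
  · rw [DirichletWalk.stepLaw, ae_map_iff hm.aemeasurable
      (measurableSet_le measurable_norm measurable_const)]
    have h1 : ∀ᵐ q ∂((betaMeasure a b).prod ((uniformSphere d).prod Λ)), 0 < q.1 ∧ q.1 < 1 :=
      Measure.quasiMeasurePreserving_fst.ae (ae_betaMeasure_mem_Ioo a b)
    have h2 : ∀ᵐ q ∂((betaMeasure a b).prod ((uniformSphere d).prod Λ)), ‖q.2.2‖ ≤ 1 :=
      (Measure.quasiMeasurePreserving_snd.comp Measure.quasiMeasurePreserving_snd).ae h.norm_le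
    filter_upwards [h1, h2] with q hq1 hq2
    refine (norm_add_le _ _).trans ?_
    rw [norm_smul, norm_smul, Real.norm_of_nonneg hq1.1.le,
      Real.norm_of_nonneg (by linarith [hq1.2]), norm_eq_of_mem_sphere]
    nlinarith
  · rw [DirichletWalk.stepLaw, integral_map hm.aemeasurable
      (Continuous.aestronglyMeasurable (by fun_prop))]
    have hexp : ∀ q : ℝ × UnitSphere d × EuclideanSpace ℝ (Fin d),
        inner ℝ (q.1 • (q.2.1 : EuclideanSpace ℝ (Fin d)) + (1 - q.1) • q.2.2) θ ^ n =
        ∑ p ∈ Finset.HasAntidiagonal.antidiagonal n, (n.choose p.1 : ℝ) *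
          ((q.1 ^ p.1 * (1 - q.1) ^ p.2) *
            (inner ℝ (q.2.1 : EuclideanSpace ℝ (Fin d)) θ ^ p.1 * inner ℝ q.2.2 θ ^ p.2)) := by
      intro q
      rw [inner_add_left, real_inner_smul_left, real_inner_smul_left,
        (Commute.all _ _).add_pow']
      refine Finset.sum_congr rfl fun p _ => ?_
      rw [nsmul_eq_mul, mul_pow, mul_pow]
      ring
    have hi1 : ∀ p : ℕ × ℕ, Integrable (fun u : ℝ => u ^ p.1 * (1 - u) ^ p.2)
        (betaMeasure a b) := by
      intro p
      refine Integrable.of_bound (Continuous.aestronglyMeasurable (by fun_prop)) 1 ?_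
      filter_upwards [ae_betaMeasure_mem_Ioo a b] with u hu
      rw [norm_mul, norm_pow, norm_pow, Real.norm_of_nonneg hu.1.le,
        Real.norm_of_nonneg (by linarith [hu.2])]
      exact mul_le_one₀ (pow_le_one₀ hu.1.le hu.2.le) (pow_nonneg (by linarith [hu.2]) _)
        (pow_le_one₀ (by linarith [hu.2]) (by linarith [hu.1]))
    have hi2 : ∀ p : ℕ, Integrable
        (fun v : UnitSphere d => inner ℝ (v : EuclideanSpace ℝ (Fin d)) θ ^ p)
        (uniformSphere d) := by
      intro p
      refine Integrable.of_bound (Continuous.aestronglyMeasurable (by fun_prop)) (‖θ‖ ^ p)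
        (Filter.Eventually.of_forall fun v => ?_)
      rw [norm_pow]
      gcongr
      exact (norm_inner_le_norm _ _).trans (by rw [norm_eq_of_mem_sphere, one_mul])
    have hi3 : ∀ p : ℕ, Integrable (fun x => inner ℝ x θ ^ p) Λ := by
      intro p
      refine Integrable.of_bound (Continuous.aestronglyMeasurable (by fun_prop)) (‖θ‖ ^ p) ?_
      filter_upwards [h.norm_le] with x hx
      rw [norm_pow]
      gcongr
      exact (norm_inner_le_norm _ _).trans (mul_le_of_le_one_left (norm_nonneg _) hx)
    simp only [hexp]
    rw [integral_finsetSum _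
      fun p _ => ((hi1 p).mul_prod ((hi2 p.1).mul_prod (hi3 p.2))).const_mul _]
    have hterm : ∀ p ∈ Finset.HasAntidiagonal.antidiagonal n,
        ∫ q, (n.choose p.1 : ℝ) * ((q.1 ^ p.1 * (1 - q.1) ^ p.2) *
            (inner ℝ (q.2.1 : EuclideanSpace ℝ (Fin d)) θ ^ p.1 * inner ℝ q.2.2 θ ^ p.2))
          ∂((betaMeasure a b).prod ((uniformSphere d).prod Λ)) =
        ‖θ‖ ^ n * n.factorial / rise (a + b) n *
          ((rise a p.1 * ballMoment (d / 2) p.1 / p.1.factorial) *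
            (rise b p.2 * ballMoment κ p.2 / p.2.factorial)) := by
      intro p hp
      rw [Finset.HasAntidiagonal.mem_antidiagonal] at hp
      rw [integral_const_mul, integral_prod_mul (fun u : ℝ => u ^ p.1 * (1 - u) ^ p.2)
        (fun q : UnitSphere d × EuclideanSpace ℝ (Fin d) =>
          inner ℝ (q.1 : EuclideanSpace ℝ (Fin d)) θ ^ p.1 * inner ℝ q.2 θ ^ p.2),
        integral_prod_mul
          (fun v : UnitSphere d => inner ℝ (v : EuclideanSpace ℝ (Fin d)) θ ^ p.1)
          (fun x => inner ℝ x θ ^ p.2), integral_betaMeasure_pow_mul_pow ha hb,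
        integral_uniformSphere_inner_pow hd, h.moment, ← hp,
        Nat.cast_choose ℝ (Nat.le_add_right p.1 p.2), Nat.add_sub_cancel_left, pow_add]
      field_simp
    rw [Finset.sum_congr rfl hterm, ← Finset.mul_sum, hc.sum_moments]
    have := rise_pos (add_pos ha hb) n
    have := n.factorial_pos
    field_simp

theorem hasBallMoments_uniformSphere (hd : 0 < d) :
    HasBallMoments ((d : ℝ) / 2)
      ((uniformSphere d).map (Subtype.val : UnitSphere d → EuclideanSpace ℝ (Fin d))) := by
  have := isProbabilityMeasure_uniformSphere hd
  have hm : Measurable (Subtype.val : UnitSphere d → EuclideanSpace ℝ (Fin d)) :=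
    measurable_subtype_coe
  refine ⟨Measure.isProbabilityMeasure_map hm.aemeasurable, ?_, fun θ p => ?_⟩
  · rw [ae_map_iff hm.aemeasurable (measurableSet_le measurable_norm measurable_const)]
    exact Filter.Eventually.of_forall fun v => (norm_eq_of_mem_sphere v).le
  · rw [integral_map hm.aemeasurable (Continuous.aestronglyMeasurable (by fun_prop))]
    exact integral_uniformSphere_inner_pow hd θ p

/-! ### Stick breaking for the generalized Dirichlet law -/

theorem lintegral_eq_lintegral_comp_smul {E : Type*} [NormedAddCommGroup E] [NormedSpace ℝ E]
    [MeasurableSpace E] [BorelSpace E] [FiniteDimensional ℝ E] (μ : Measure E)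
    [μ.IsAddHaarMeasure] {r : ℝ} (hr : 0 < r) {f : E → ENNReal} (hf : Measurable f) :
    ∫⁻ x, f x ∂μ = ENNReal.ofReal (r ^ Module.finrank ℝ E) * ∫⁻ x, f (r • x) ∂μ := by
  have hr' : 0 < r ^ Module.finrank ℝ E := by positivity
  rw [← lintegral_map hf (measurable_const_smul r), Measure.map_addHaar_smul μ hr.ne',
    lintegral_smul_measure, smul_eq_mul, ← mul_assoc, ← ENNReal.ofReal_mul hr'.le, abs_inv,
    abs_of_pos hr', mul_inv_cancel₀ hr'.ne', ENNReal.ofReal_one, one_mul]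

/-- Writing interval sums over the whole index type lets `Fin.sum_univ_succ` split off the index 0.
-/
theorem sum_eq_sum_univ_ite {m : ℕ} (s : Finset (Fin m)) (g : Fin m → ℝ) :
    ∑ l ∈ s, g l = ∑ l, if l ∈ s then g l else 0 := by
  rw [Finset.sum_ite_mem, Finset.univ_inter]

section FinSums

variable {n : ℕ} (f : Fin (n + 1) → ℝ) (k : Fin n)

theorem sum_Iio_succ : ∑ l ∈ Finset.Iio k.succ, f l = f 0 + ∑ l ∈ Finset.Iio k, f l.succ := by
  rw [sum_eq_sum_univ_ite, sum_eq_sum_univ_ite (Finset.Iio k), Fin.sum_univ_succ]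
  simp

theorem sum_Iic_succ : ∑ l ∈ Finset.Iic k.succ, f l = f 0 + ∑ l ∈ Finset.Iic k, f l.succ := by
  rw [sum_eq_sum_univ_ite, sum_eq_sum_univ_ite (Finset.Iic k), Fin.sum_univ_succ]
  simp

theorem sum_Ici_succ : ∑ l ∈ Finset.Ici k.succ, f l = ∑ l ∈ Finset.Ici k, f l.succ := by
  rw [sum_eq_sum_univ_ite, sum_eq_sum_univ_ite (Finset.Ici k), Fin.sum_univ_succ]
  simp

theorem sum_Ioi_succ : ∑ l ∈ Finset.Ioi k.succ, f l = ∑ l ∈ Finset.Ioi k, f l.succ := by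
  rw [sum_eq_sum_univ_ite, sum_eq_sum_univ_ite (Finset.Ioi k), Fin.sum_univ_succ]
  simp

theorem sum_Ioi_zero : ∑ l ∈ Finset.Ioi (0 : Fin (n + 1)), f l = ∑ l : Fin n, f l.succ := by
  rw [sum_eq_sum_univ_ite, Fin.sum_univ_succ]
  simp

theorem sum_Iic_eq (g : Fin n → ℝ) :
    ∑ l ∈ Finset.Iic k, g l = g k + ∑ l ∈ Finset.Iio k, g l := by
  rw [← Finset.Iio_insert, Finset.sum_insert (by simp)]

end FinSums

theorem cons_mem_simplex_iff {n : ℕ} {t u : ℝ} (ht : 0 < t) (hu : 0 < u ∧ u < 1)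
    (σ : Fin n → ℝ) :
    (Fin.cons (t * u) (fun k => t * (1 - u) * σ k) : Fin (n + 1) → ℝ) ∈ simplex (n + 1) t ↔
      σ ∈ simplex n 1 := by
  have hr : 0 < t * (1 - u) := mul_pos ht (by linarith [hu.2])
  simp only [simplex, Set.mem_ofPred_eq, Fin.forall_fin_succ, Fin.cons_zero, Fin.cons_succ,
    sum_Iio_succ, ← Finset.mul_sum]
  have h0 : 0 < t * u ∧ t * u < t - ∑ l ∈ Finset.Iio (0 : Fin (n + 1)),
      (Fin.cons (t * u) (fun k => t * (1 - u) * σ k) : Fin (n + 1) → ℝ) l := by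
    refine ⟨mul_pos ht hu.1, ?_⟩
    rw [show Finset.Iio (0 : Fin (n + 1)) = ∅ by ext; simp]
    simp only [Finset.sum_empty, sub_zero]
    nlinarith [hu.2]
  rw [and_iff_right h0]
  refine forall_congr' fun k => and_congr (mul_pos_iff_of_pos_left hr) ?_
  rw [show t - (t * u + t * (1 - u) * ∑ l ∈ Finset.Iio k, σ l) =
    t * (1 - u) * (1 - ∑ l ∈ Finset.Iio k, σ l) by ring, mul_lt_mul_iff_right₀ hr]

/-- The total exponent `∑ (a_k + b_k - 1)` of a generalized Dirichlet density. -/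
def gdWeight {n : ℕ} (a b : Fin n → ℝ) : ℝ := ∑ k, (a k + b k - 1)

theorem gdConst_succ {n : ℕ} (a b : Fin (n + 1) → ℝ) (t : ℝ) :
    gdConst a b t = 1 / t ^ (a 0 + b 0 - 1 + gdWeight (Fin.tail a) (Fin.tail b)) *
      (1 / beta (a 0) (b 0 + gdWeight (Fin.tail a) (Fin.tail b))) *
      gdConst (Fin.tail a) (Fin.tail b) 1 := by
  have h0 : ∑ l ∈ Finset.Ici (0 : Fin (n + 1)), (a l + b l - 1) =
      a 0 + b 0 - 1 + gdWeight (Fin.tail a) (Fin.tail b) := by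
    rw [show Finset.Ici (0 : Fin (n + 1)) = Finset.univ by ext; simp, Fin.sum_univ_succ]
    rfl
  simp only [gdConst, Fin.prod_univ_succ, sum_Ici_succ, sum_Ioi_succ, h0, sum_Ioi_zero,
    Fin.sum_univ_succ (fun k => a k + b k - 1), Real.one_rpow]
  have h1 : ∑ k : Fin n, (a k.succ + b k.succ - 1) = gdWeight (Fin.tail a) (Fin.tail b) := rfl
  rw [h1, beta]
  generalize gdWeight (Fin.tail a) (Fin.tail b) = S
  rw [one_div_div, show 1 + (a 0 + b 0 - 1 + S) = a 0 + (b 0 + S) by ring]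
  simp only [Fin.tail]
  ring

/-- The stick-breaking form of the generalized Dirichlet density. -/
theorem gdDensity_cons {n : ℕ} (a b : Fin (n + 1) → ℝ) {t u : ℝ} (ht : 0 < t)
    (hu : 0 < u ∧ u < 1) (σ : Fin n → ℝ) :
    t * (t * (1 - u)) ^ n *
        gdDensity a b t (Fin.cons (t * u) fun k => t * (1 - u) * σ k) =
      betaPDFReal (a 0) (b 0 + gdWeight (Fin.tail a) (Fin.tail b)) u *
        gdDensity (Fin.tail a) (Fin.tail b) 1 σ := by
  have hu1 : 0 < 1 - u := by linarith [hu.2]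
  have hr : 0 < t * (1 - u) := mul_pos ht hu1
  by_cases hσ : σ ∈ simplex n 1
  swap
  · rw [gdDensity, gdDensity, Set.indicator_of_notMem (by rwa [cons_mem_simplex_iff ht hu]),
      Set.indicator_of_notMem hσ, mul_zero, mul_zero]
  rw [gdDensity, gdDensity, Set.indicator_of_mem (by rwa [cons_mem_simplex_iff ht hu]),
    Set.indicator_of_mem hσ, gdConst_succ, betaPDFReal, if_pos hu, Fin.prod_univ_succ]
  set S := gdWeight (Fin.tail a) (Fin.tail b) with hS
  have h0 : ∑ l ∈ Finset.Iic (0 : Fin (n + 1)),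
      (Fin.cons (t * u) (fun k => t * (1 - u) * σ k) : Fin (n + 1) → ℝ) l = t * u := by
    rw [show Finset.Iic (0 : Fin (n + 1)) = {0} by ext; simp]
    simp
  -- Each later coordinate contributes t(1-u) to the exponent (a_k - 1) + (b_k - 1), in total S - n;
  -- the Jacobian will restore the missing n.
  have hprod : ∏ k : Fin n, ((t * (1 - u) * σ k) ^ (a k.succ - 1) *
        (t - (t * u + ∑ l ∈ Finset.Iic k, t * (1 - u) * σ l)) ^ (b k.succ - 1)) =
      (t * (1 - u)) ^ (S - n) * ∏ k : Fin n, (σ k ^ (a k.succ - 1) *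
        (1 - ∑ l ∈ Finset.Iic k, σ l) ^ (b k.succ - 1)) := by
    have hSn : S - n = ∑ k : Fin n, (a k.succ - 1 + (b k.succ - 1)) := by
      have : ∀ k : Fin n, a k.succ - 1 + (b k.succ - 1) = a k.succ + b k.succ - 1 - 1 :=
        fun k => by ring
      simp only [this]
      rw [Finset.sum_sub_distrib]
      simp [hS, gdWeight, Fin.tail]
    rw [hSn, Real.rpow_sum_of_pos hr, ← Finset.prod_mul_distrib]
    refine Finset.prod_congr rfl fun k _ => ?_
    have h1 : 0 < σ k := (hσ k).1
    have h2 : 0 < 1 - ∑ l ∈ Finset.Iic k, σ l := by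
      rw [sum_Iic_eq]
      linarith [(hσ k).2]
    rw [← Finset.mul_sum, show t - (t * u + t * (1 - u) * ∑ l ∈ Finset.Iic k, σ l) =
      t * (1 - u) * (1 - ∑ l ∈ Finset.Iic k, σ l) by ring, Real.mul_rpow hr.le h1.le,
      Real.mul_rpow hr.le h2.le, Real.rpow_add hr]
    ring
  simp only [Fin.cons_zero, Fin.cons_succ, sum_Iic_succ, h0, hprod]
  have e1 : t - t * u = t * (1 - u) := by ring
  have e2 : (t * (1 - u)) ^ n * ((t * (1 - u)) ^ (b 0 - 1) * (t * (1 - u)) ^ (S - n)) =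
      t ^ (b 0 + S - 1) * (1 - u) ^ (b 0 + S - 1) := by
    rw [← Real.rpow_natCast, ← Real.rpow_add hr, ← Real.rpow_add hr, ← Real.mul_rpow ht.le hu1.le]
    ring_nf
  have e3 : t * t ^ (a 0 - 1) * t ^ (b 0 + S - 1) = t ^ (a 0 + b 0 - 1 + S) := by
    nth_rewrite 1 [← Real.rpow_one t]
    rw [← Real.rpow_add ht, ← Real.rpow_add ht]
    ring_nf
  have e4 : 0 < t ^ (a 0 + b 0 - 1 + S) := Real.rpow_pos_of_pos ht _
  rw [e1, Real.mul_rpow ht.le hu.1.le]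
  simp only [Fin.tail]
  calc _ = (t * t ^ (a 0 - 1) * ((t * (1 - u)) ^ n * ((t * (1 - u)) ^ (b 0 - 1) *
        (t * (1 - u)) ^ (S - n)))) / t ^ (a 0 + b 0 - 1 + S) *
        (1 / beta (a 0) (b 0 + S) * u ^ (a 0 - 1)) *
        (gdConst (Fin.tail a) (Fin.tail b) 1 *
        ∏ k : Fin n, (σ k ^ (a k.succ - 1) *
          (1 - ∑ l ∈ Finset.Iic k, σ l) ^ (b k.succ - 1))) := by ring
    _ = _ := by
      rw [e2, ← mul_assoc (t * t ^ (a 0 - 1)), e3, mul_div_cancel_left₀ _ e4.ne']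
      ring

theorem measurableSet_simplex (n : ℕ) (t : ℝ) : MeasurableSet (simplex n t) := by
  have : simplex n t = ⋂ k, {τ | 0 < τ k ∧ τ k < t - ∑ l ∈ Finset.Iio k, τ l} := by
    ext τ
    simp [simplex]
  rw [this]
  refine MeasurableSet.iInter fun k => ?_
  have h1 : Measurable fun τ : Fin n → ℝ => τ k := measurable_pi_apply k
  have h2 : Measurable fun τ : Fin n → ℝ => t - ∑ l ∈ Finset.Iio k, τ l := by fun_prop
  exact (measurableSet_lt measurable_const h1).inter (measurableSet_lt h1 h2)

theorem measurable_gdDensity {n : ℕ} (a b : Fin n → ℝ) (t : ℝ) : Measurable (gdDensity a b t) :=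
  Measurable.indicator (by fun_prop) (measurableSet_simplex n t)

/-- Stick breaking: the first coordinate is a beta distributed fraction of the total length,
the others split the remaining length independently, again with a generalized Dirichlet law. -/
theorem generalizedDirichlet_succ {n : ℕ} (a b : Fin (n + 1) → ℝ) {t : ℝ} (ht : 0 < t)
    (ha : 0 < a 0) (hb : 0 < b 0 + gdWeight (Fin.tail a) (Fin.tail b)) :
    generalizedDirichlet a b t =
      ((betaMeasure (a 0) (b 0 + gdWeight (Fin.tail a) (Fin.tail b))).prod
        (generalizedDirichlet (Fin.tail a) (Fin.tail b) 1)).map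
        fun q => (Fin.cons (t * q.1) fun k => t * (1 - q.1) * q.2 k : Fin (n + 1) → ℝ) := by
  set β := b 0 + gdWeight (Fin.tail a) (Fin.tail b) with hβ
  have hm : Measurable fun q : ℝ × (Fin n → ℝ) =>
      (Fin.cons (t * q.1) fun k => t * (1 - q.1) * q.2 k : Fin (n + 1) → ℝ) := by
    refine measurable_pi_lambda _ fun k => ?_
    refine Fin.cases ?_ (fun k => ?_) k
    · simp only [Fin.cons_zero]; fun_prop
    · simp only [Fin.cons_succ]; fun_prop
  have hmc : Measurable fun q : ℝ × (Fin n → ℝ) => (Fin.cons q.1 q.2 : Fin (n + 1) → ℝ) := by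
    refine measurable_pi_lambda _ fun k => ?_
    refine Fin.cases ?_ (fun k => ?_) k
    · simp only [Fin.cons_zero]; fun_prop
    · simp only [Fin.cons_succ]; fun_prop
  have hw := (measurable_gdDensity a b t).ennreal_ofReal
  have hw' := (measurable_gdDensity (Fin.tail a) (Fin.tail b) 1).ennreal_ofReal
  refine Measure.ext_of_lintegral _ fun f hf => ?_
  have hfm : Measurable fun q : ℝ × (Fin n → ℝ) =>
      f (Fin.cons (t * q.1) fun k => t * (1 - q.1) * q.2 k) := hf.comp hm
  rw [generalizedDirichlet, lintegral_withDensity_eq_lintegral_mul _ hw hf,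
    lintegral_map hf hm, generalizedDirichlet, lintegral_prod _ hfm.aemeasurable,
    betaMeasure, lintegral_withDensity_eq_lintegral_mul _ (measurable_betaPDF _ _)
      hfm.lintegral_prod_right',
    ← (volume_preserving_piFinSuccAbove (fun _ : Fin (n + 1) => ℝ) 0).symm.lintegral_comp
      (hw.mul hf), Measure.volume_eq_prod]
  have hcons : ∀ q : ℝ × (Fin n → ℝ),
      (MeasurableEquiv.piFinSuccAbove (fun _ : Fin (n + 1) => ℝ) 0).symm q = Fin.cons q.1 q.2 := by
    intro q
    change Fin.insertNth (α := fun _ => ℝ) 0 q.1 q.2 = _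
    rw [Fin.insertNth_zero']
  simp only [hcons, Pi.mul_apply]
  have hF : Measurable fun q : ℝ × (Fin n → ℝ) =>
      ENNReal.ofReal (gdDensity a b t (Fin.cons q.1 q.2)) * f (Fin.cons q.1 q.2) :=
    (hw.comp hmc).mul (hf.comp hmc)
  -- The Jacobian arises in two dilations: by t in the first coordinate here, then by t(1-u) in the
  -- other n for fixed u in (0, 1). Outside this interval both densities vanish.
  rw [lintegral_prod _ hF.aemeasurable,
    lintegral_eq_lintegral_comp_smul volume ht hF.lintegral_prod_right',
    ← lintegral_const_mul' _ _ ENNReal.ofReal_ne_top]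
  refine lintegral_congr fun u => ?_
  simp only [smul_eq_mul, Module.finrank_self, pow_one]
  by_cases hu : 0 < u ∧ u < 1
  · have hr : 0 < t * (1 - u) := mul_pos ht (by linarith [hu.2])
    have hfu : Measurable fun σ : Fin n → ℝ =>
        f (Fin.cons (t * u) fun k => t * (1 - u) * σ k) := hfm.comp measurable_prodMk_left
    rw [lintegral_eq_lintegral_comp_smul volume hr (f := fun σ : Fin n → ℝ =>
        ENNReal.ofReal (gdDensity a b t (Fin.cons (t * u) σ)) * f (Fin.cons (t * u) σ))
        (hF.comp measurable_prodMk_left),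
      lintegral_withDensity_eq_lintegral_mul _ hw' hfu, ← lintegral_const_mul'
        _ _ ENNReal.ofReal_ne_top, ← lintegral_const_mul' _ _ ENNReal.ofReal_ne_top,
      betaPDF, ← lintegral_const_mul' _ _ ENNReal.ofReal_ne_top]
    refine lintegral_congr fun σ => ?_
    simp only [Pi.mul_apply, Module.finrank_fin_fun]
    have hsm : ((t * (1 - u)) • σ) = fun k => t * (1 - u) * σ k := by
      ext k; simp
    rw [hsm, ← mul_assoc, ← mul_assoc, ← mul_assoc, ← ENNReal.ofReal_mul ht.le,
      ← ENNReal.ofReal_mul (by positivity), gdDensity_cons a b ht hu,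
      ENNReal.ofReal_mul (betaPDFReal_nonneg ha hb u)]
  · have h1 : betaPDF (a 0) β u = 0 := by simp [betaPDF, betaPDFReal, hu]
    have h2 : ∀ σ : Fin n → ℝ, gdDensity a b t (Fin.cons (t * u) σ) = 0 := by
      intro σ
      refine Set.indicator_of_notMem (fun h => hu ?_) _
      have h0 := h 0
      rw [show Finset.Iio (0 : Fin (n + 1)) = ∅ by ext; simp] at h0
      simp only [Fin.cons_zero, Finset.sum_empty, sub_zero] at h0
      exact ⟨pos_of_mul_pos_right h0.1 ht.le, by nlinarith [h0.2]⟩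
    simp [h1, h2]

theorem generalizedDirichlet_zero (a b : Fin 0 → ℝ) :
    generalizedDirichlet a b 1 = Measure.dirac (fun k => k.elim0) := by
  have h1 : (fun τ : Fin 0 → ℝ => ENNReal.ofReal (gdDensity a b 1 τ)) = 1 := by
    ext τ
    simp [gdDensity, simplex, gdConst]
  rw [generalizedDirichlet, h1, withDensity_one, Measure.volume_pi_eq_dirac fun k => k.elim0]

/-! ### Recursion for the law of the endpoint -/

/-- The endpoint of a path with `n` steps of durations `τ_k` and a last one that lasts until
time `t`, at unit speed. -/
def endpoint {n : ℕ} (t : ℝ) (τ : Fin n → ℝ) (v : Fin (n + 1) → UnitSphere d) :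
    EuclideanSpace ℝ (Fin d) :=
  ∑ k, τ k • (v k.castSucc : EuclideanSpace ℝ (Fin d)) +
    (t - ∑ k, τ k) • (v (Fin.last n) : EuclideanSpace ℝ (Fin d))

theorem measurable_endpoint (n : ℕ) (t : ℝ) :
    Measurable fun q : (Fin n → ℝ) × (Fin (n + 1) → UnitSphere d) => endpoint t q.1 q.2 := by
  unfold endpoint
  fun_prop

theorem endpoint_cons {n : ℕ} (t u : ℝ) (σ : Fin n → ℝ) (v₀ : UnitSphere d)
    (v : Fin (n + 1) → UnitSphere d) :
    endpoint t (Fin.cons (t * u) (fun k => t * (1 - u) * σ k) : Fin (n + 1) → ℝ)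
        (Fin.cons v₀ v : Fin (n + 2) → UnitSphere d) =
      t • (u • (v₀ : EuclideanSpace ℝ (Fin d)) + (1 - u) • endpoint 1 σ v) := by
  rw [endpoint, endpoint, Fin.sum_univ_succ, Fin.sum_univ_succ, ← Fin.succ_last]
  simp only [Fin.cons_zero, Fin.cons_succ, Fin.castSucc_zero, ← Fin.succ_castSucc]
  rw [← Finset.mul_sum]
  simp only [mul_smul, ← Finset.smul_sum]
  module

/-- The law of the endpoint of a walk with generalized Dirichlet durations and independent
uniform directions. -/
def endpointLaw (d : ℕ) {n : ℕ} (a b : Fin n → ℝ) (t : ℝ) : Measure (EuclideanSpace ℝ (Fin d)) :=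
  ((generalizedDirichlet a b t).prod (Measure.pi fun _ : Fin (n + 1) => uniformSphere d)).map
    fun q => endpoint t q.1 q.2

theorem endpointLaw_zero (hd : 0 < d) (a b : Fin 0 → ℝ) : endpointLaw d a b 1 =
    (uniformSphere d).map (Subtype.val : UnitSphere d → EuclideanSpace ℝ (Fin d)) := by
  have := isProbabilityMeasure_uniformSphere hd
  rw [endpointLaw, generalizedDirichlet_zero, Measure.dirac_prod,
    Measure.map_map (measurable_endpoint 0 1) measurable_prodMk_left]
  conv_rhs => rw [← (measurePreserving_eval (fun _ : Fin 1 => uniformSphere d) 0).map_eq]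
  rw [Measure.map_map measurable_subtype_coe (measurable_pi_apply _)]
  congr 1
  ext v
  simp [endpoint]

/-- Regroups (durations, directions) into (first fraction, first direction, rest of the walk). -/
theorem lintegral_prodProdComm {α β γ δ : Type*} [MeasurableSpace α] [MeasurableSpace β]
    [MeasurableSpace γ] [MeasurableSpace δ] (μ : Measure α) (ν : Measure β) (ρ : Measure γ)
    (κ : Measure δ) [SFinite μ] [SFinite ν] [SFinite ρ] [SFinite κ]
    {F : (α × β) × γ × δ → ENNReal} (hF : Measurable F) :
    ∫⁻ q, F q ∂((μ.prod ν).prod (ρ.prod κ)) =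
      ∫⁻ q, F ((q.1, q.2.2.1), (q.2.1, q.2.2.2)) ∂(μ.prod (ρ.prod (ν.prod κ))) := by
  rw [lintegral_prod _ hF.aemeasurable, lintegral_prod _ (hF.lintegral_prod_right').aemeasurable,
    lintegral_prod _ (by fun_prop)]
  refine lintegral_congr fun x => ?_
  rw [lintegral_prod _ (by fun_prop)]
  have h1 : ∀ y, ∫⁻ z, F ((x, y), z) ∂(ρ.prod κ) = ∫⁻ u, ∫⁻ v, F ((x, y), (u, v)) ∂κ ∂ρ :=
    fun y => lintegral_prod _ (by fun_prop)
  have h2 : ∀ u, ∫⁻ z, F ((x, z.1), (u, z.2)) ∂(ν.prod κ) = ∫⁻ y, ∫⁻ v, F ((x, y), (u, v)) ∂κ ∂ν :=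
    fun u => lintegral_prod _ (by fun_prop)
  simp only [h1, h2]
  refine lintegral_lintegral_swap (Measurable.aemeasurable ?_)
  exact Measurable.lintegral_prod_right' (ν := κ)
    (f := fun q : (β × γ) × δ => F ((x, q.1.1), (q.1.2, q.2))) (by fun_prop)

theorem endpointLaw_succ (hd : 0 < d) {n : ℕ} (a b : Fin (n + 1) → ℝ) {t : ℝ} (ht : 0 < t)
    (ha : 0 < a 0) (hb : 0 < b 0 + gdWeight (Fin.tail a) (Fin.tail b)) :
    endpointLaw d a b t =
      (stepLaw (a 0) (b 0 + gdWeight (Fin.tail a) (Fin.tail b))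
        (endpointLaw d (Fin.tail a) (Fin.tail b) 1)).map fun x => t • x := by
  have := isProbabilityMeasure_uniformSphere hd
  have := isProbabilityMeasureBeta ha hb
  have hG : SFinite (generalizedDirichlet (Fin.tail a) (Fin.tail b) 1) := by
    unfold generalizedDirichlet; infer_instance
  have hm : Measurable fun q : ℝ × (Fin n → ℝ) =>
      (Fin.cons (t * q.1) fun k => t * (1 - q.1) * q.2 k : Fin (n + 1) → ℝ) := by
    refine measurable_pi_lambda _ fun k => ?_
    refine Fin.cases ?_ (fun k => ?_) k
    · simp only [Fin.cons_zero]; fun_prop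
    · simp only [Fin.cons_succ]; fun_prop
  have hmp := (measurePreserving_piFinSuccAbove (fun _ : Fin (n + 2) => uniformSphere d) 0).symm
  have hcons : ∀ q : UnitSphere d × (Fin (n + 1) → UnitSphere d),
      (MeasurableEquiv.piFinSuccAbove (fun _ : Fin (n + 2) => UnitSphere d) 0).symm q =
        Fin.cons q.1 q.2 := by
    intro q
    change Fin.insertNth (α := fun _ => UnitSphere d) 0 q.1 q.2 = _
    rw [Fin.insertNth_zero']
  have hstep : Measurable fun q : ℝ × UnitSphere d × EuclideanSpace ℝ (Fin d) =>
      q.1 • (q.2.1 : EuclideanSpace ℝ (Fin d)) + (1 - q.1) • q.2.2 := by fun_prop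
  have hE : Measurable fun q : (Fin n → ℝ) × (Fin (n + 1) → UnitSphere d) =>
      endpoint 1 q.1 q.2 := measurable_endpoint n 1
  have hL : SFinite (endpointLaw d (Fin.tail a) (Fin.tail b) 1) := by
    unfold endpointLaw; infer_instance
  refine Measure.ext_of_lintegral _ fun f hf => ?_
  have hft : Measurable fun x : EuclideanSpace ℝ (Fin d) => f (t • x) :=
    hf.comp (measurable_const_smul t)
  have hfs : Measurable fun q : ℝ × UnitSphere d × EuclideanSpace ℝ (Fin d) =>
      f (t • (q.1 • (q.2.1 : EuclideanSpace ℝ (Fin d)) + (1 - q.1) • q.2.2)) := hft.comp hstep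
  have hfe : Measurable fun q : (Fin (n + 1) → ℝ) × (Fin (n + 2) → UnitSphere d) =>
      f (endpoint t q.1 q.2) := hf.comp (measurable_endpoint _ t)
  have hrhs := lintegral_prodProdComm (betaMeasure (a 0) (b 0 + gdWeight (Fin.tail a) (Fin.tail b)))
    (generalizedDirichlet (Fin.tail a) (Fin.tail b) 1) (uniformSphere d)
    (Measure.pi fun _ : Fin (n + 1) => uniformSphere d) (hfe.comp (hm.prodMap hmp.measurable))
  rw [endpointLaw, lintegral_map hf (measurable_endpoint _ t), ← hmp.map_eq,
    generalizedDirichlet_succ a b ht ha hb, Measure.map_prod_map _ _ hm hmp.measurable,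
    lintegral_map hfe (hm.prodMap hmp.measurable)]
  refine hrhs.trans ?_
  have hP : SFinite ((generalizedDirichlet (Fin.tail a) (Fin.tail b) 1).prod
      (Measure.pi fun _ : Fin (n + 1) => uniformSphere d)) := inferInstance
  have hUP : SFinite ((uniformSphere d).prod ((generalizedDirichlet (Fin.tail a) (Fin.tail b) 1).prod
      (Measure.pi fun _ : Fin (n + 1) => uniformSphere d))) := inferInstance
  have h1 := Measure.map_prod_map (uniformSphere d)
    ((generalizedDirichlet (Fin.tail a) (Fin.tail b) 1).prod
      (Measure.pi fun _ : Fin (n + 1) => uniformSphere d)) measurable_id hE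
  have h2 := Measure.map_prod_map (betaMeasure (a 0) (b 0 + gdWeight (Fin.tail a) (Fin.tail b)))
    ((uniformSphere d).prod ((generalizedDirichlet (Fin.tail a) (Fin.tail b) 1).prod
      (Measure.pi fun _ : Fin (n + 1) => uniformSphere d))) measurable_id
    (measurable_id.prodMap hE)
  rw [← h1, Measure.map_id, Measure.map_id] at h2
  rw [lintegral_map hf (measurable_const_smul t), stepLaw, lintegral_map hft hstep,
    endpointLaw, h2, lintegral_map hfs (measurable_id.prodMap (measurable_id.prodMap hE))]
  refine lintegral_congr fun q => ?_
  simp only [Function.comp_apply, Prod.map, hcons, endpoint_cons, id]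

/-! ### Conditioning on the number of changes of direction -/

theorem numChanges_eq_iff {Ω : Type*} (T : ℕ → Ω → ℝ) (t : ℝ) (ω : Ω) {n : ℕ} (hn : 1 ≤ n) :
    numChanges T t ω = n ↔ T n ω ≤ t ∧ ∀ k, n < k → t < T k ω := by
  have hle : ∀ m : ℕ, numChanges T t ω ≤ m ↔ ∀ k, m < k → 1 ≤ k → t < T k ω := by
    intro m
    simp only [numChanges, iSup_le_iff, Nat.cast_le, and_imp]
    refine forall_congr' fun k => ⟨fun h h1 h2 => ?_, fun h h1 h2 => ?_⟩
    · by_contra! h3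
      exact absurd (h h2 h3) (by omega)
    · by_contra! h3
      exact absurd (h h3 h1) (by linarith)
  constructor
  · intro h
    have h1 := (hle n).1 h.le
    refine ⟨?_, fun k hk => h1 k hk (by omega)⟩
    by_contra! h2
    -- If the n-th instant came after t, the supremum would be at most n - 1, a true predecessor
    -- because 1 ≤ n.
    have h3 : numChanges T t ω ≤ ((n - 1 : ℕ) : ℕ∞) := by
      rw [hle]
      intro k hk hk1
      rcases (show n ≤ k by omega).eq_or_lt with rfl | h4
      · exact h2
      · exact h1 k h4 hk1
    rw [h, Nat.cast_le] at h3
    omega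
  · rintro ⟨h1, h2⟩
    refine le_antisymm ((hle n).2 fun k hk _ => h2 k hk) ?_
    exact le_iSup₂_of_le (f := fun (k : ℕ) (_ : 1 ≤ k ∧ T k ω ≤ t) => (k : ℕ∞)) n ⟨hn, h1⟩ le_rfl

/-- Given an event and a random variable that depend only on a random element independent of `W`,
the variable and `W` are conditionally independent, and `W` keeps its law. -/
theorem map_cond_prodMk_of_indepFun {Ω α β γ : Type*} [MeasurableSpace Ω] [MeasurableSpace α]
    [MeasurableSpace β] [MeasurableSpace γ] {P : Measure Ω} [IsProbabilityMeasure P]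
    {W : Ω → α} {Z : Ω → β} (hW : Measurable W) (hZ : Measurable Z) (h : IndepFun W Z P)
    {D : Set β} (hD : MeasurableSet D) {g : β → γ} (hg : Measurable g) :
    (P[|Z ⁻¹' D]).map (fun ω => (g (Z ω), W ω)) =
      ((P[|Z ⁻¹' D]).map fun ω => g (Z ω)).prod (P.map W) := by
  have hE : MeasurableSet (Z ⁻¹' D) := hZ hD
  have := Measure.isProbabilityMeasure_map hW.aemeasurable (μ := P)
  have hgZ : Measurable fun ω => g (Z ω) := hg.comp hZ
  symm
  refine Measure.prod_eq fun A C hA hC => ?_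
  rw [Measure.map_apply (hgZ.prodMk hW) (hA.prod hC), Measure.map_apply hW hC,
    Measure.map_apply hgZ hA, cond_apply hE, cond_apply hE, mul_assoc]
  congr 1
  have h1 := h.measure_inter_preimage_eq_mul C (D ∩ g ⁻¹' A) hC (hD.inter (hg hA))
  rw [mul_comm, show Z ⁻¹' D ∩ (fun ω => g (Z ω)) ⁻¹' A = Z ⁻¹' (D ∩ g ⁻¹' A) by rfl, ← h1]
  congr 1
  ext ω
  simp only [Set.mem_inter_iff, Set.mem_preimage, Set.mem_prod]
  tauto

theorem position_law {Ω : Type*} [MeasurableSpace Ω] (P : Measure Ω) [IsProbabilityMeasure P]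
    {d n j h i : ℕ} (hn1 : 1 ≤ n) {c t : ℝ} {T : ℕ → Ω → ℝ}
    {V : ℕ → Ω → UnitSphere d} (hwalk : IsSwitchingWalk d h i j P T V t)
    (hn : P {ω | numChanges T t ω = n} ≠ 0) :
    (P[|{ω | numChanges T t ω = n}]).map (position c T V t) =
      (endpointLaw d (switchA d j n) (switchB d h i j n) t).map fun x => c • x := by
  -- The conditioning event is the preimage of `D` under the sequence of instants, so conditioning
  -- leaves the directions independent of the durations and with unchanged law.
  set D : Set (ℕ → ℝ) := {f | numChanges (fun k (f : ℕ → ℝ) => f k) t f = n} with hDdef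
  have hD : MeasurableSet D := by
    have : D = {f : ℕ → ℝ | f n ≤ t} ∩ ⋂ k, ⋂ (_ : n < k), {f : ℕ → ℝ | t < f k} := by
      ext f
      simp [hDdef, numChanges_eq_iff _ t f hn1]
    rw [this]
    exact (measurableSet_le (measurable_pi_apply n) measurable_const).inter
      (MeasurableSet.iInter fun k => MeasurableSet.iInter fun _ =>
        measurableSet_lt measurable_const (measurable_pi_apply k))
  have hZ : Measurable fun ω k => T k ω := measurable_pi_lambda _ hwalk.measurable_time
  have hED : {ω | numChanges T t ω = n} = (fun ω k => T k ω) ⁻¹' D := rfl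
  have hW : Measurable fun ω (k : Fin (n + 1)) => V k ω :=
    measurable_pi_lambda _ fun k => hwalk.measurable_direction k
  have hWlaw : P.map (fun ω (k : Fin (n + 1)) => V k ω) =
      Measure.pi fun _ => uniformSphere d := by
    have h1 : iIndepFun (fun k : Fin (n + 1) => V k) P :=
      hwalk.indep_direction.precomp Fin.val_injective
    rw [(iIndepFun_iff_map_fun_eq_pi_map
      fun k : Fin (n + 1) => (hwalk.measurable_direction k).aemeasurable).1 h1]
    simp only [hwalk.law_direction]
  have hind : IndepFun (fun ω (k : Fin (n + 1)) => V k ω) (fun ω k => T k ω) P :=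
    hwalk.indep_direction_time.comp (φ := fun (v : ℕ → UnitSphere d) (k : Fin (n + 1)) => v k)
      (by fun_prop) measurable_id
  have hg : Measurable fun (f : ℕ → ℝ) (k : Fin n) => f (k + 1) - f k := by fun_prop
  have hjoint := map_cond_prodMk_of_indepFun hW hZ hind hD hg
  rw [← hED, hwalk.law_duration n hn1 hn, hWlaw] at hjoint
  have hτ : Measurable fun ω (k : Fin n) => T (k + 1) ω - T k ω := hg.comp hZ
  have hm : Measurable fun q : (Fin n → ℝ) × (Fin (n + 1) → UnitSphere d) => endpoint t q.1 q.2 :=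
    measurable_endpoint n t
  rw [endpointLaw, ← hjoint, Measure.map_map (measurable_const_smul c) hm,
    Measure.map_map ((measurable_const_smul c).comp hm) (hτ.prodMk hW)]
  refine Measure.map_congr ?_
  have hE : MeasurableSet {ω | numChanges T t ω = n} := hZ hD
  filter_upwards [ae_cond_mem hE, cond_absolutelyContinuous.ae_le hwalk.time_zero] with ω hω h0
  simp only [position, hω, ENat.toNat_natCast, Function.comp_apply, endpoint]
  -- The durations telescope to T_n - T_0, and T_0 = 0, so the last step lasts t - T_n.
  rw [Finset.sum_range, ← Finset.sum_range (fun k => T (k + 1) ω - T k ω), Finset.sum_range_sub (fun k => T k ω),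
    h0, sub_zero]
  simp

/-! ### Arithmetic of the switching-phase parameters -/

/-- The parameters `a_{k + 1}` of a walk with more than `j` changes of direction. -/
def phaseA (d j k : ℕ) : ℝ := if k + 1 ≤ j then (d : ℝ) - 1 else (d : ℝ) / 2 - 1

/-- The parameters `b_{k + 1}` of a walk with `n > j` changes of direction. -/
def phaseB (d h i j n k : ℕ) : ℝ :=
  if k + 1 = j then ((n : ℝ) - j + 1) * ((d : ℝ) / 2 - 1) + i + h + 1
  else if k + 1 = n then (d : ℝ) / 2 - i else 1

/-- The parameter of the isotropic law of the endpoint of the walk after its `p`-th change of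
direction. -/
def phaseKappa (d j n p : ℕ) : ℝ :=
  if p < j then ((n : ℝ) - j + 1) * ((d : ℝ) / 2 - 1) + 1 + ((j : ℝ) - p) * (((d : ℝ) - 1) / 2)
  else ((n : ℝ) - p + 1) * ((d : ℝ) / 2 - 1) + 1

/-- The total weight of the parameters after the `p`-th change of direction. -/
def phaseWeight (d h i j n p : ℕ) : ℝ :=
  if p < j then 2 * phaseKappa d j n p - 2 + h
  else if p < n then ((n : ℝ) - p + 1) * ((d : ℝ) / 2 - 1) - i
  else 0

/-- This is where the parameters of the walk matter: the weights add up, the beta parameters are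
positive, and the resulting pair falls under Vandermonde before the switch and under Rothe or Hagen
after it. -/
theorem phase_step {d n j h i p : ℕ} (hd : 3 ≤ d) (hjn : j < n) (hh : h ≤ 1) (hi : i ≤ 1)
    (hp : p < n) :
    phaseA d j p + (phaseB d h i j n p + phaseWeight d h i j n (p + 1)) - 1 =
        phaseWeight d h i j n p ∧
      0 < phaseA d j p ∧ 0 < phaseB d h i j n p + phaseWeight d h i j n (p + 1) ∧
      HypConv (phaseA d j p) (d / 2) (phaseB d h i j n p + phaseWeight d h i j n (p + 1))
        (phaseKappa d j n (p + 1)) (phaseKappa d j n p) := by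
  have hd' : (3 : ℝ) ≤ d := by exact_mod_cast hd
  have hx : 0 < (d : ℝ) / 2 - 1 := by linarith
  have hjn' : (j : ℝ) < n := by exact_mod_cast hjn
  have hh' : (0 : ℝ) ≤ h := h.cast_nonneg
  by_cases hpj : p < j
  · have hpj' : (p : ℝ) + 1 ≤ j := by exact_mod_cast hpj
    have hA : phaseA d j p = 2 * ((d : ℝ) / 2) - 1 := by
      rw [phaseA, if_pos (by omega)]; ring
    have hK : phaseKappa d j n p =
        ((n : ℝ) - j + 1) * ((d : ℝ) / 2 - 1) + 1 + ((j : ℝ) - p) * (((d : ℝ) - 1) / 2) := by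
      rw [phaseKappa, if_pos hpj]
    have hK1 : phaseKappa d j n (p + 1) =
        ((n : ℝ) - j + 1) * ((d : ℝ) / 2 - 1) + 1 + ((j : ℝ) - p - 1) * (((d : ℝ) - 1) / 2) := by
      rw [phaseKappa]
      split_ifs with h1
      · push_cast; ring
      · have : j = p + 1 := by omega
        subst this
        push_cast; ring
    have hW : phaseWeight d h i j n p = 2 * phaseKappa d j n p - 2 + h := by
      rw [phaseWeight, if_pos hpj]
    -- Let κ be the parameter after the step. At the switch b_j = κ + i + h meets the second-phase
    -- weight κ - 1 - i, so `i` disappears; before it, b = 1 meets the weight 2κ - 2 + h.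
    have hB : phaseB d h i j n p + phaseWeight d h i j n (p + 1) =
        2 * phaseKappa d j n (p + 1) - 1 + h := by
      rw [phaseB, phaseWeight]
      by_cases h1 : p + 1 = j
      · rw [if_pos h1, if_neg (by omega), if_pos (by omega), hK1]
        subst h1
        push_cast; ring
      · rw [if_neg h1, if_neg (by omega), if_pos (by omega)]
        ring
    have hKpos : 1 ≤ phaseKappa d j n (p + 1) := by
      rw [hK1]
      have h1 : 0 ≤ ((n : ℝ) - j + 1) * ((d : ℝ) / 2 - 1) :=
        mul_nonneg (by linarith) hx.le
      have h2 : 0 ≤ ((j : ℝ) - p - 1) * (((d : ℝ) - 1) / 2) :=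
        mul_nonneg (by linarith) (by linarith)
      linarith
    rw [hB, hA, hW]
    refine ⟨by rw [hK, hK1]; ring, by linarith, by linarith, ?_⟩
    have := hypConv_vandermonde (κ₀ := (d : ℝ) / 2) (κ₁ := phaseKappa d j n (p + 1))
      (by linarith) (by linarith) hh
    convert this using 1
    rw [hK, hK1]
    ring
  · have hpn : (p : ℝ) + 1 ≤ n := by exact_mod_cast hp
    have hA : phaseA d j p = (d : ℝ) / 2 - 1 := by
      rw [phaseA, if_neg (by omega)]
    have hK : phaseKappa d j n p = ((n : ℝ) - p + 1) * ((d : ℝ) / 2 - 1) + 1 := by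
      rw [phaseKappa, if_neg hpj]
    have hK1 : phaseKappa d j n (p + 1) = ((n : ℝ) - p) * ((d : ℝ) / 2 - 1) + 1 := by
      rw [phaseKappa, if_neg (by omega)]
      push_cast; ring
    have hW : phaseWeight d h i j n p = ((n : ℝ) - p + 1) * ((d : ℝ) / 2 - 1) - i := by
      rw [phaseWeight, if_neg hpj, if_pos hp]
    have hB : phaseB d h i j n p + phaseWeight d h i j n (p + 1) =
        ((n : ℝ) - p) * ((d : ℝ) / 2 - 1) + 1 - i := by
      rw [phaseB, phaseWeight, if_neg (show ¬ p + 1 = j by omega),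
        if_neg (show ¬ p + 1 < j by omega)]
      by_cases h1 : p + 1 = n
      · rw [if_pos h1, if_neg (by omega)]
        subst h1
        push_cast; ring
      · rw [if_neg h1, if_pos (by omega)]
        push_cast; ring
    have hy : 0 < ((n : ℝ) - p) * ((d : ℝ) / 2 - 1) := mul_pos (by linarith) hx
    rw [hB, hA, hW, hK, hK1]
    have e1 : (d : ℝ) / 2 = (d : ℝ) / 2 - 1 + 1 := by ring
    have e2 : ((n : ℝ) - p + 1) * ((d : ℝ) / 2 - 1) + 1 =
      (d : ℝ) / 2 - 1 + ((n : ℝ) - p) * ((d : ℝ) / 2 - 1) + 1 := by ring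
    -- With κ the parameter after the step, the second beta parameter is κ - i: Hagen for i = 0,
    -- Rothe for i = 1.
    interval_cases i
    · refine ⟨by push_cast; ring, hx, by push_cast; linarith, ?_⟩
      rw [e2, Nat.cast_zero, sub_zero]
      nth_rewrite 2 [e1]
      exact hypConv_hagen hx hy
    · refine ⟨by push_cast; ring, hx, by push_cast; linarith, ?_⟩
      rw [e2, Nat.cast_one, add_sub_cancel_right]
      nth_rewrite 2 [e1]
      exact hypConv_rothe hx hy

theorem tail_shift {m : ℕ} (f : ℕ → ℝ) (p : ℕ) :
    Fin.tail (fun k : Fin (m + 1) => f (p + k)) = fun k : Fin m => f (p + 1 + k) := by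
  ext k
  simp only [Fin.tail, Fin.val_succ]
  congr 1
  omega

/-- The endpoint of the walk after its `p`-th change of direction. -/
theorem hasBallMoments_endpointLaw_phase {d n j h i : ℕ} (hd : 3 ≤ d) (hjn : j < n) (hh : h ≤ 1)
    (hi : i ≤ 1) (m p : ℕ) (hmp : p + m = n) :
    gdWeight (fun k : Fin m => phaseA d j (p + k)) (fun k : Fin m => phaseB d h i j n (p + k)) =
        phaseWeight d h i j n p ∧
      HasBallMoments (phaseKappa d j n p)
        (endpointLaw d (fun k : Fin m => phaseA d j (p + k))
          (fun k : Fin m => phaseB d h i j n (p + k)) 1) := by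
  have hd0 : 0 < d := by omega
  -- The total weight must be carried along with the law, since it enters the beta parameter of the
  -- preceding step. With no change left, a single uniform direction remains, for which κ = d/2.
  induction m generalizing p with
  | zero =>
    have hpn : p = n := by omega
    subst hpn
    refine ⟨?_, ?_⟩
    · simp [gdWeight, phaseWeight, hjn.not_gt]
    · rw [endpointLaw_zero hd0]
      convert hasBallMoments_uniformSphere hd0 using 1
      rw [phaseKappa, if_neg hjn.not_gt]
      ring
  | succ m ih =>
    obtain ⟨ihW, ihM⟩ := ih (p + 1) (by omega)
    obtain ⟨h1, h2, h3, h4⟩ := phase_step (p := p) hd hjn hh hi (by omega)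
    set a : Fin (m + 1) → ℝ := fun k => phaseA d j (p + k) with ha
    set b : Fin (m + 1) → ℝ := fun k => phaseB d h i j n (p + k) with hb
    have hta : Fin.tail a = fun k : Fin m => phaseA d j (p + 1 + k) := tail_shift _ p
    have htb : Fin.tail b = fun k : Fin m => phaseB d h i j n (p + 1 + k) := tail_shift _ p
    have ha0 : a 0 = phaseA d j p := by simp [ha]
    have hb0 : b 0 = phaseB d h i j n p := by simp [hb]
    rw [← hta, ← htb] at ihW ihM
    rw [← ha0, ← hb0, ← ihW] at h1 h4
    rw [← hb0, ← ihW] at h3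
    rw [← ha0] at h2
    refine ⟨?_, ?_⟩
    · rw [← h1, gdWeight, Fin.sum_univ_succ, gdWeight]
      simp only [Fin.tail]
      ring
    · rw [endpointLaw_succ hd0 a b one_pos h2 h3]
      simp only [one_smul]
      rw [Measure.map_id']
      exact ihM.stepLaw hd0 h2 h3 h4

/-! ### From moments to the density -/

theorem integral_withDensity_inner_pow {d : ℕ}
    {f : EuclideanSpace ℝ (Fin d) → ℝ} (hf : Measurable f) (hf0 : ∀ x, 0 ≤ f x)
    (θ : EuclideanSpace ℝ (Fin d)) (p : ℕ) :
    ∫ x, inner ℝ x θ ^ p ∂(volume.withDensity fun x => ENNReal.ofReal (f x)) =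
      ∫ x, f x * inner ℝ x θ ^ p := by
  rw [integral_withDensity_eq_integral_toReal_smul hf.ennreal_ofReal
    (Filter.Eventually.of_forall fun _ => ENNReal.ofReal_lt_top)]
  simp only [ENNReal.toReal_ofReal (hf0 _), smul_eq_mul]

/-- The law of a dilation of an isotropic law in the unit ball given by its moments. -/
theorem HasBallMoments.map_smul_eq_withDensity {d : ℕ} (hd : 0 < d) {R β C : ℝ} (hR : 0 < R)
    (hβ : 0 < β) (hC0 : 0 ≤ C)
    (hC : C * R ^ (d + 2 * (β - 1)) * Real.pi ^ ((d : ℝ) / 2) * Real.Gamma β =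
      Real.Gamma (d / 2 + β))
    {Λ : Measure (EuclideanSpace ℝ (Fin d))} (hΛ : HasBallMoments (d / 2 + β) Λ) :
    Λ.map (fun x => R • x) = volume.withDensity fun x => ENNReal.ofReal
      ((Metric.ball 0 R).indicator (fun x => C * (R ^ 2 - ‖x‖ ^ 2) ^ (β - 1)) x) := by
  have := hΛ.isProbabilityMeasure
  set f : EuclideanSpace ℝ (Fin d) → ℝ :=
    (Metric.ball 0 R).indicator (fun x => C * (R ^ 2 - ‖x‖ ^ 2) ^ (β - 1)) with hf
  have hfm : Measurable f := Measurable.indicator (by fun_prop) measurableSet_ball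
  have hf0 : ∀ x, 0 ≤ f x := by
    intro x
    refine Set.indicator_nonneg (fun y hy => ?_) x
    rw [mem_ball_zero_iff] at hy
    have : 0 ≤ R ^ 2 - ‖y‖ ^ 2 := by nlinarith [norm_nonneg y]
    positivity
  have hmom := integral_ball_indicator_mul_inner_pow hd hR hβ hC
  -- The moment formula of order 0 gives the integral 1, and a nonzero Bochner integral forces
  -- integrability.
  have hint : Integrable f := by
    refine Integrable.of_integral_ne_zero ?_
    have h0 := hmom 0 0
    simp only [pow_zero, mul_one, one_mul] at h0
    rw [h0]
    simp [ballMoment, rise]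
  have hfin : IsFiniteMeasure (volume.withDensity fun x => ENNReal.ofReal (f x)) :=
    isFiniteMeasure_withDensity_ofReal hint.2
  have hsm : Measurable fun x : EuclideanSpace ℝ (Fin d) => R • x := measurable_const_smul R
  refine ext_of_inner_moments (R := R) ?_ ?_ fun θ p => ?_
  · rw [ae_map_iff hsm.aemeasurable (measurableSet_le measurable_norm measurable_const)]
    filter_upwards [hΛ.norm_le] with x hx
    rw [norm_smul, Real.norm_of_nonneg hR.le]
    exact mul_le_of_le_one_right hR.le hx
  · rw [ae_withDensity_iff hfm.ennreal_ofReal]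
    refine Filter.Eventually.of_forall fun x hx => ?_
    by_contra h
    refine hx ?_
    rw [hf, Set.indicator_of_notMem (by rw [mem_ball_zero_iff]; linarith), ENNReal.ofReal_zero]
  · rw [integral_withDensity_inner_pow hfm hf0, hmom,
      integral_map hsm.aemeasurable (Continuous.aestronglyMeasurable (by fun_prop))]
    simp only [real_inner_smul_left, mul_pow]
    rw [integral_const_mul, hΛ.moment]

end DirichletWalk

end

theorem mainTheorem1 {Ω : Type*} [MeasurableSpace Ω] (P : Measure Ω) [IsProbabilityMeasure P]
    (d n j h i : ℕ) (hd : 3 ≤ d) (hj : 1 ≤ j) (hjn : j < n) (hh : h ≤ 1) (hi : i ≤ 1)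
    (c t : ℝ) (hc : 0 < c) (ht : 0 < t)
    (T : ℕ → Ω → ℝ) (V : ℕ → Ω → UnitSphere d)
    (hwalk : IsSwitchingWalk d h i j P T V t)
    (hn : P {ω | numChanges T t ω = n} ≠ 0) :
    (P[|{ω | numChanges T t ω = n}]).map (position c T V t) =
      volume.withDensity
        (fun x => ENNReal.ofReal ((Metric.ball 0 (c * t)).indicator (walkDensity d n j c t) x)) := by
  have hd0 : 0 < d := by omega
  have hd' : (3 : ℝ) ≤ d := by exact_mod_cast hd
  have hx : 0 < (d : ℝ) / 2 - 1 := by linarith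
  have hj' : (1 : ℝ) ≤ j := by exact_mod_cast hj
  have hR : 0 < c * t := mul_pos hc ht
  have hA : switchA d j n = fun k : Fin n => phaseA d j (0 + k) := by
    ext k
    simp [switchA, phaseA, hjn.not_ge]
  have hB : switchB d h i j n = fun k : Fin n => phaseB d h i j n (0 + k) := by
    ext k
    simp [switchB, phaseB, hjn.not_ge]
  -- Stick breaking at total length t and at length 1 leads to the same unit-time step law, so t
  -- enters only as a dilation.
  have hlaw : endpointLaw d (switchA d j n) (switchB d h i j n) t =
      (endpointLaw d (switchA d j n) (switchB d h i j n) 1).map fun x => t • x := by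
    obtain ⟨m, rfl⟩ : ∃ m, n = m + 1 := ⟨n - 1, by omega⟩
    obtain ⟨hW, -⟩ := hasBallMoments_endpointLaw_phase hd hjn hh hi m 1 (by omega)
    obtain ⟨-, h2, h3, -⟩ := phase_step (p := 0) hd hjn hh hi (by omega)
    rw [zero_add, ← hW, ← zero_add 1, ← tail_shift, ← tail_shift, ← hA, ← hB] at h3
    have ha0 : 0 < switchA d j (m + 1) 0 := by rw [hA]; simpa using h2
    have hb0 : 0 < switchB d h i j (m + 1) 0 + gdWeight (Fin.tail (switchA d j (m + 1)))
        (Fin.tail (switchB d h i j (m + 1))) := by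
      rw [show switchB d h i j (m + 1) 0 = phaseB d h i j (m + 1) 0 by rw [hB]; simp]
      exact h3
    rw [endpointLaw_succ hd0 _ _ ht ha0 hb0, endpointLaw_succ hd0 _ _ one_pos ha0 hb0]
    simp only [one_smul, Measure.map_id']
  obtain ⟨-, hM⟩ := hasBallMoments_endpointLaw_phase hd hjn hh hi n 0 (by omega)
  rw [← hA, ← hB] at hM
  set β : ℝ := (n : ℝ) * ((d : ℝ) / 2 - 1) + (j : ℝ) / 2 with hβ
  have hβ0 : 0 < β := by positivity
  -- The j first-phase steps each add (d-1)/2 to the parameter (n-j+1)(d/2-1) + 1 reached at the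
  -- switch; the excess over d/2 is β, one more than the exponent in the density.
  have hκ : phaseKappa d j n 0 = d / 2 + β := by
    rw [phaseKappa, if_pos (by omega), hβ]
    push_cast
    ring
  rw [hκ] at hM
  have hG : Real.Gamma (((n : ℝ) + 1) * ((d : ℝ) / 2 - 1) + (j : ℝ) / 2 + 1) =
      Real.Gamma (d / 2 + β) := by
    congr 1
    rw [hβ]
    ring
  have hexp : 2 * ((n : ℝ) + 1) * ((d : ℝ) / 2 - 1) + (j : ℝ) = d + 2 * (β - 1) := by
    rw [hβ]
    ring
  have hGβ := Real.Gamma_pos_of_pos hβ0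
  have hGκ : 0 < Real.Gamma (d / 2 + β) := Real.Gamma_pos_of_pos (by positivity)
  have hRp : 0 < (c * t) ^ (d + 2 * (β - 1)) := Real.rpow_pos_of_pos hR _
  have hpi : 0 < Real.pi ^ ((d : ℝ) / 2) := Real.rpow_pos_of_pos Real.pi_pos _
  rw [position_law P (by omega) hwalk hn, hlaw,
    Measure.map_map (measurable_const_smul c) (measurable_const_smul t)]
  have hcomp : ((fun x : EuclideanSpace ℝ (Fin d) => c • x) ∘ fun x => t • x) =
      fun x => (c * t) • x := by
    ext1 x
    simp [mul_smul]
  rw [hcomp, hM.map_smul_eq_withDensity hd0 hR hβ0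
    (C := Real.Gamma (d / 2 + β) / Real.Gamma β /
      (Real.pi ^ ((d : ℝ) / 2) * (c * t) ^ (d + 2 * (β - 1)))) (by positivity) (by field_simp)]
  congr 1
  ext x
  congr 2
  ext y
  rw [walkDensity, hG, hexp, ← hβ, mul_pow]
  ring
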